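/- **Setting.** A (cc-qq) quantum interference channel has finite input alphabets $\mathcal X_1,\mathcal X_2$, finite-dimensional output systems $B_1,B_2$, and assigns to each pair $(x_1,x_2)$ a density operator $\rho^{B_1B_2}_{x_1,x_2}$; $n$ uses with inputs $x_1^n,x_2^n$ produce $\rho^{B_1^nB_2^n}_{x_1^n,x_2^n}=\bigotimes_{i=1}^n\rho^{B_1B_2}_{x_{1,i},x_{2,i}}$. An $(n,R_1,R_2,\epsilon)$ code consists of message sets $\mathcal M_i$ with $|\mathcal M_i|=\lceil 2^{nR_i}\rceil$, codebooks $\{x_i^n(m_i)\}_{m_i\in\mathcal M_i}\subseteq\mathcal X_i^n$ for $i=1,2$, and POVMs $\{\Lambda_{m_1}\}_{m_1\in\mathcal M_1}$ on $B_1^n$ and $\{\Gamma_{m_2}\}_{m_2\in\mathcal M_2}$ on $B_2^n$, such that $$\frac1{|\mathcal M_1||\mathcal M_2|}\sum_{m_1,m_2}\operatorname{Tr}\Big\{(I-\Lambda_{m_1}\otimes\Gamma_{m_2})\,\rho^{B_1^nB_2^n}_{x_1^n(m_1),x_2^n(m_2)}\Big\}\le\epsilon .$$ A pair $(R_1,R_2)$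 is *achievable* if for all $\epsilon,\delta>0$ and all sufficiently large $n$ there is an $(n,R_1-\delta,R_2-\delta,\epsilon)$ code. **Split inputs.** Let $X_{1p},X_{1c},X_{2c},X_{2p}$ be independent random variables with arbitrary distributions on finite alphabets (the personal and common parts of the two senders), and let $f_1,f_2$ be functions such that $x_1=f_1(x_{1p},x_{1c})$ and $x_2=f_2(x_{2p},x_{2c})$ are the channel inputs. Let $\rho^{B_j}_x$ be the reduced state on $B_j$ of the channel output for $x=(x_{1p},x_{1c},x_{2c},x_{2p})$. For a set $S$ of indices let $\bar\rho^{B_j}_{x_S}$ be the average of $\rho^{B_j}_x$ over the inputs with index outside $S$, and let $H(B_j|X_S)=\mathbb E\,[H(\bar\rho^{B_j}_{X_S})]$, where $H(\rho)=-\operatorname{Tr}\rho\log_2\rho$. For an index $l\notin T$ put $I(X_l;B_j|X_T)=H(B_j|X_T)-H(B_j|X_lX_T)$, written $I(X_l;B_j)$ if $T=\emptyset$. **Proposition (rate-splitting with successive decoding for the interference channel).** Let $\pi_1$ be any ordering (permutation) of the indices $(1p,1c,2c)$ and $\pi_2$ any ordering of the indices $(2p,2c,1c)$: the orders in which Receivers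 1 and 2 decode. Suppose that for $j=1,2$ the real numbers $R^{(j)}_l$ satisfy $$R^{(j)}_{\pi_j(1)}\le I(X_{\pi_j(1)};B_j),\qquad R^{(j)}_{\pi_j(2)}\le I(X_{\pi_j(2)};B_j|X_{\pi_j(1)}),\qquad R^{(j)}_{\pi_j(3)}\le I(X_{\pi_j(3)};B_j|X_{\pi_j(1)}X_{\pi_j(2)}).$$ Then the rate pair $$P=\Big(R^{(1)}_{1p}+\min\{R^{(1)}_{1c},R^{(2)}_{1c}\},\ \min\{R^{(1)}_{2c},R^{(2)}_{2c}\}+R^{(2)}_{2p}\Big)$$ is achievable for the quantum interference channel. -/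

import Mathlib

open scoped Kronecker ComplexOrder

noncomputable section

namespace RateSplitIC

/-! ### Interference channels, codes and achievable rate pairs -/

/-- A two-party cc-qq interference channel: to every pair of classical input symbols it assigns
a density operator on `ℂ^B₁ ⊗ ℂ^B₂`, where `B₁` and `B₂` index orthonormal bases of the two
(finite-dimensional) output systems. -/
structure CQInterferenceChannel (X₁ X₂ B₁ B₂ : Type*)
    [Fintype B₁] [Fintype B₂] [DecidableEq B₁] [DecidableEq B₂] where
  /-- The output state for the input pair `(x₁, x₂)`. -/
  state : X₁ → X₂ → Matrix (B₁ × B₂) (B₁ × B₂) ℂ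
  state_posSemidef : ∀ x₁ x₂, (state x₁ x₂).PosSemidef
  state_trace : ∀ x₁ x₂, (state x₁ x₂).trace = 1

/-- The partial trace over the second tensor factor. -/
def traceSecond {B₁ B₂ : Type*} [Fintype B₂] (M : Matrix (B₁ × B₂) (B₁ × B₂) ℂ) :
    Matrix B₁ B₁ ℂ :=
  Matrix.of fun b b' => ∑ c, M (b, c) (b', c)

/-- The partial trace over the first tensor factor. -/
def traceFirst {B₁ B₂ : Type*} [Fintype B₁] (M : Matrix (B₁ × B₂) (B₁ × B₂) ℂ) :
    Matrix B₂ B₂ ℂ :=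
  Matrix.of fun c c' => ∑ b, M (b, c) (b, c')

/-- The number of messages in a code of rate `R` and blocklength `n`, namely `2 ^ (n R)` rounded
up to an integer. -/
def numMessages (n : ℕ) (R : ℝ) : ℕ := ⌈(2 : ℝ) ^ ((n : ℝ) * R)⌉₊

/-- A positive operator-valued measure on `ℂ^K` with outcomes in `M`. -/
structure POVM (M K : Type*) [Fintype M] [Fintype K] [DecidableEq K] where
  /-- The measurement operator of each outcome. -/
  op : M → Matrix K K ℂ
  op_posSemidef : ∀ m, (op m).PosSemidef
  sum_op : ∑ m, op m = 1

section Codes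

variable {X₁ X₂ B₁ B₂ : Type*} [Fintype B₁] [Fintype B₂] [DecidableEq B₁] [DecidableEq B₂]

/-- The output of `n` independent channel uses: the tensor product of the states
`state (x₁ i) (x₂ i)`, with the systems grouped as `B₁ⁿ ⊗ B₂ⁿ`. -/
def CQInterferenceChannel.blockState (N : CQInterferenceChannel X₁ X₂ B₁ B₂) {n : ℕ}
    (x₁ : Fin n → X₁) (x₂ : Fin n → X₂) :
    Matrix ((Fin n → B₁) × (Fin n → B₂)) ((Fin n → B₁) × (Fin n → B₂)) ℂ :=
  Matrix.of fun b b' => ∏ i, N.state (x₁ i) (x₂ i) (b.1 i, b.2 i) (b'.1 i, b'.2 i)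

/-- An `(n, R₁, R₂, ε)` code for the channel `N`. -/
structure Code (N : CQInterferenceChannel X₁ X₂ B₁ B₂) (n : ℕ) (R₁ R₂ ε : ℝ) where
  /-- The codebook of Sender 1. -/
  codeword₁ : Fin (numMessages n R₁) → (Fin n → X₁)
  /-- The codebook of Sender 2. -/
  codeword₂ : Fin (numMessages n R₂) → (Fin n → X₂)
  /-- The measurement of Receiver 1, who wants the message of Sender 1. -/
  decoder₁ : POVM (Fin (numMessages n R₁)) (Fin n → B₁)
  /-- The measurement of Receiver 2, who wants the message of Sender 2. -/
  decoder₂ : POVM (Fin (numMessages n R₂)) (Fin n → B₂)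
  /-- The error probability, averaged over all pairs of messages, is at most `ε`. -/
  average_error_le :
    (1 / ((numMessages n R₁ : ℝ) * (numMessages n R₂ : ℝ))) *
      ∑ m₁, ∑ m₂,
        (((1 - decoder₁.op m₁ ⊗ₖ decoder₂.op m₂) *
          N.blockState (codeword₁ m₁) (codeword₂ m₂)).trace).re ≤ ε

/-- The rate pair `(R₁, R₂)` is achievable for `N`. -/
def Achievable (N : CQInterferenceChannel X₁ X₂ B₁ B₂) (R₁ R₂ : ℝ) : Prop :=
  ∀ ε > 0, ∀ δ > 0, ∃ n₀ : ℕ, ∀ n ≥ n₀, Nonempty (Code N n (R₁ - δ) (R₂ - δ) ε)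

end Codes

/-! ### Split inputs and information quantities -/

/-- The four parts of the messages: personal and common part of Sender 1, common and personal
part of Sender 2. -/
inductive Part
  | p1 | c1 | c2 | p2
  deriving DecidableEq

instance : Fintype Part where
  elems := {Part.p1, Part.c1, Part.c2, Part.p2}
  complete := fun l => by cases l <;> decide

/-- The parts decoded by Receiver 1. -/
def decoded₁ : Finset Part := {Part.p1, Part.c1, Part.c2}

/-- The parts decoded by Receiver 2. -/
def decoded₂ : Finset Part := {Part.p2, Part.c2, Part.c1}

/-- The von Neumann entropy `-Tr (ρ log₂ ρ)` of a density matrix, as the base two Shannon entropy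
of its eigenvalues (and `0` for matrices that are not Hermitian). -/
def vonNeumannEntropy {B : Type*} [Fintype B] [DecidableEq B] (ρ : Matrix B B ℂ) : ℝ :=
  open Classical in
  if h : ρ.IsHermitian then (∑ b, Real.negMulLog (h.eigenvalues b)) / Real.log 2 else 0

section Information

variable {𝒳 : Part → Type*} [∀ l, Fintype (𝒳 l)] {B : Type*} [Fintype B] [DecidableEq B]

/-- The product distribution with marginals `p l`. -/
def prodDist (p : ∀ l, 𝒳 l → ℝ) (x : ∀ l, 𝒳 l) : ℝ := ∏ l, p l (x l)

/-- The averaged state `ρ̄_{x_S}`: the inputs in `S` are fixed to those of `x`, and the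
inputs outside `S` are averaged over their (independent) distributions. -/
def averagedState (p : ∀ l, 𝒳 l → ℝ) (ρ : (∀ l, 𝒳 l) → Matrix B B ℂ) (S : Finset Part)
    (x : ∀ l, 𝒳 l) : Matrix B B ℂ :=
  ∑ y, (prodDist p y : ℂ) • ρ (S.piecewise x y)

/-- The conditional entropy `H(B | X_S) = 𝔼_X [H(ρ̄_{X_S})]` of the classical-quantum state
`∑ x, p(x) |x⟩⟨x| ⊗ ρ_x`. For `S = ∅` this is the entropy `H(B)`. -/
def condEntropy (p : ∀ l, 𝒳 l → ℝ) (ρ : (∀ l, 𝒳 l) → Matrix B B ℂ) (S : Finset Part) : ℝ :=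
  ∑ x, prodDist p x * vonNeumannEntropy (averagedState p ρ S x)

/-- The conditional mutual information `I(X_l ; B | X_T) = H(B | X_T) - H(B | X_l X_T)`. For
`T = ∅` this is the mutual information `I(X_l ; B)`. -/
def condMutualInfo (p : ∀ l, 𝒳 l → ℝ) (ρ : (∀ l, 𝒳 l) → Matrix B B ℂ) (l : Part)
    (T : Finset Part) : ℝ :=
  condEntropy p ρ T - condEntropy p ρ (insert l T)

end Information

section SplitInputs

variable {X₁ X₂ B₁ B₂ : Type*} [Fintype B₁] [Fintype B₂] [DecidableEq B₁] [DecidableEq B₂]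
  {𝒳 : Part → Type*}

/-- The state of `B₁ B₂` when the parts `x` are combined into channel inputs by the mixing
functions `f₁` and `f₂`. -/
def splitState (N : CQInterferenceChannel X₁ X₂ B₁ B₂)
    (f₁ : 𝒳 Part.p1 → 𝒳 Part.c1 → X₁) (f₂ : 𝒳 Part.p2 → 𝒳 Part.c2 → X₂) (x : ∀ l, 𝒳 l) :
    Matrix (B₁ × B₂) (B₁ × B₂) ℂ :=
  N.state (f₁ (x Part.p1) (x Part.c1)) (f₂ (x Part.p2) (x Part.c2))

/-- The state seen by Receiver 1. -/
def splitState₁ (N : CQInterferenceChannel X₁ X₂ B₁ B₂)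
    (f₁ : 𝒳 Part.p1 → 𝒳 Part.c1 → X₁) (f₂ : 𝒳 Part.p2 → 𝒳 Part.c2 → X₂) (x : ∀ l, 𝒳 l) :
    Matrix B₁ B₁ ℂ :=
  traceSecond (splitState N f₁ f₂ x)

/-- The state seen by Receiver 2. -/
def splitState₂ (N : CQInterferenceChannel X₁ X₂ B₁ B₂)
    (f₁ : 𝒳 Part.p1 → 𝒳 Part.c1 → X₁) (f₂ : 𝒳 Part.p2 → 𝒳 Part.c2 → X₂) (x : ∀ l, 𝒳 l) :
    Matrix B₂ B₂ ℂ :=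
  traceFirst (splitState N f₁ f₂ x)

end SplitInputs

/-- The rates `R` of the parts obey the successive decoding constraints for the decoding order
`π 0 → π 1 → π 2` of the parts in `D`, at a receiver whose state is `ρ`. -/
structure SuccessiveRates {𝒳 : Part → Type*} [∀ l, Fintype (𝒳 l)] {B : Type*} [Fintype B]
    [DecidableEq B] (p : ∀ l, 𝒳 l → ℝ) (ρ : (∀ l, 𝒳 l) → Matrix B B ℂ) {D : Finset Part}
    (π : Fin 3 ≃ D) (R : Part → ℝ) : Prop where
  first : R (π 0) ≤ condMutualInfo p ρ (π 0) ∅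
  second : R (π 1) ≤ condMutualInfo p ρ (π 1) {(π 0 : Part)}
  third : R (π 2) ≤ condMutualInfo p ρ (π 2) {(π 0 : Part), (π 1 : Part)}

end RateSplitIC

end

/-! The proof is random coding with sequential decoding. Every part `l` gets its own i.i.d.
codebook, and a receiver identifies its three parts one after the other, testing the candidate
messages of a part in turn and accepting the first that passes.

Non-commuting measurements are controlled by an operator form of the quantum union bound,
`SequentialBound.one_sub_star_mul_self_le`: if `K` is a product of effects `A i`, then `1 - star K *
K ≤ 4 * ∑ (1 - A i)`. One application covers all three stages, so the error of a message tuple is at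
most four times the sum, over the stages, of the rejection of the right message and the acceptances
of wrong ones, each computed in the undisturbed state with the earlier parts known correctly.

For a stage decoding `l` after `T`, with `S = insert l T`, the test is `P * Q * P`. Here `P` keeps
the eigenvalues of the state averaged given `T` that are at most about `2 ^ (-n H(B|X_T))`, and `Q`
those of the state averaged given `S` that are at least about `2 ^ (-n H(B|X_S))`. A Chernoff bound
shows that the right message passes (`exists_stageTests`). Since the rank of `Q` is at most about `2
^ (n H(B|X_S))`, a wrong message passes with probability about `2 ^ (-n I(X_l;B|X_T))`
(`sum_codebookWeight_wrong_le`), so rates below the mutual information suffice (`exists_decoder`).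

Both receivers use the same random codebook. A common part is sent at the smaller of its two rates,
the two errors add up, and some fixed codebook is at least as good as the average. -/

noncomputable section

set_option linter.unusedSectionVars false

namespace RateSplitIC

/-! ### Sequential measurements in star-ordered rings -/

section Sequential

variable {R : Type*} [Ring R] [StarRing R] [PartialOrder R] [StarOrderedRing R]

/-- `K` behaves, up to the error `E`, like a sequence of tests all of which are passed with high
probability. -/
def SequentialBound (K E : R) : Prop :=
  ∀ W : R, 2 * ((W - K * W) + star (W - K * W)) ≤ 4 * E + (star W * W - star (K * W) * (K * W))

theorem sub_mul_self_nonneg_of_effect {A : R} (h0 : 0 ≤ A) (h1 : A ≤ 1) : 0 ≤ A - A * A := by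
  have hA : star A = A := (IsSelfAdjoint.of_nonneg h0).star_eq
  have h1' : 0 ≤ 1 - A := sub_nonneg.2 h1
  have e1 := star_left_conjugate_nonneg h1' A
  have e2 := star_left_conjugate_nonneg h0 (1 - A)
  have := add_nonneg e1 e2
  rw [star_sub, star_one, hA] at this
  convert this using 1
  noncomm_ring

/-- Completing the square: the difference of the two sides is `star (2 - W) * (1 - A) * (2 - W) +
star W * (A - A * A) * W`. -/
theorem SequentialBound.of_effect {A : R} (h0 : 0 ≤ A) (h1 : A ≤ 1) :
    SequentialBound A (1 - A) := by
  intro W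
  have hA : star A = A := (IsSelfAdjoint.of_nonneg h0).star_eq
  have e1 := star_left_conjugate_nonneg (sub_nonneg.2 h1) (1 + 1 - W)
  have e2 := star_left_conjugate_nonneg (sub_mul_self_nonneg_of_effect h0 h1) W
  have := add_nonneg e1 e2
  rw [← sub_nonneg]
  convert this using 1
  simp only [star_sub, star_add, star_one, star_mul, hA]
  noncomm_ring

/-- Quantifying over `W` makes the bound composable: apply it to `W` for `K₁` and to `K₁ * W` for
`K₂`; both sides telescope. -/
theorem SequentialBound.mul {K₁ E₁ K₂ E₂ : R} (h₂ : SequentialBound K₂ E₂)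
    (h₁ : SequentialBound K₁ E₁) : SequentialBound (K₂ * K₁) (E₁ + E₂) := by
  intro W
  have := add_le_add (h₁ W) (h₂ (K₁ * W))
  convert this using 1 <;> simp only [star_sub, star_mul, mul_assoc] <;> noncomm_ring

/-- Take `W = 1` and add twice `star (1 - K) * (1 - K) ≥ 0`; the terms linear in `K` cancel. -/
theorem SequentialBound.one_sub_star_mul_self_le {K E : R} (h : SequentialBound K E) :
    1 - star K * K ≤ 4 * E := by
  have h1 := h 1
  have h2 := star_mul_self_nonneg (1 - K)
  rw [← sub_nonneg] at h1 ⊢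
  have := add_nonneg h1 (add_nonneg h2 h2)
  convert this using 1
  simp only [star_sub, mul_one, star_one]
  noncomm_ring

/-- The product of the operators `1 - t j` for `j < k`, later ones on the left. -/
def rejectBefore (t : ℕ → R) : ℕ → R
  | 0 => 1
  | k + 1 => (1 - t k) * rejectBefore t k

/-- The operator of accepting the test `t k` after having rejected all earlier ones. -/
def acceptAt (t : ℕ → R) (k : ℕ) : R := t k * rejectBefore t k

variable {t : ℕ → R}

theorem SequentialBound.rejectBefore (h0 : ∀ k, 0 ≤ t k) (h1 : ∀ k, t k ≤ 1) (k : ℕ) :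
    SequentialBound (rejectBefore t k) (∑ j ∈ Finset.range k, t j) := by
  induction k with
  | zero =>
    intro W
    simp [RateSplitIC.rejectBefore]
  | succ k ih =>
    rw [Finset.sum_range_succ]
    refine SequentialBound.mul ?_ ih
    simpa using SequentialBound.of_effect (sub_nonneg.2 (h1 k)) (sub_le_self _ (h0 k))

theorem SequentialBound.acceptAt (h0 : ∀ k, 0 ≤ t k) (h1 : ∀ k, t k ≤ 1) (k : ℕ) :
    SequentialBound (acceptAt t k) ((∑ j ∈ Finset.range k, t j) + (1 - t k)) :=
  (SequentialBound.of_effect (h0 k) (h1 k)).mul (SequentialBound.rejectBefore h0 h1 k)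

/-- Each step loses weight because `t² + (1 - t)² = 1 - 2 (t - t²) ≤ 1` for an effect `t`. -/
theorem sum_acceptAt_add_rejectBefore_le (h0 : ∀ k, 0 ≤ t k) (h1 : ∀ k, t k ≤ 1) (L : ℕ) :
    ∑ k ∈ Finset.range L, star (acceptAt t k) * acceptAt t k
      + star (rejectBefore t L) * rejectBefore t L ≤ 1 := by
  induction L with
  | zero => simp [rejectBefore]
  | succ L ih =>
    refine le_trans ?_ ih
    rw [Finset.sum_range_succ, add_assoc]
    refine add_le_add le_rfl ?_
    have hA : star (t L) = t L := (IsSelfAdjoint.of_nonneg (h0 L)).star_eq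
    have e := star_left_conjugate_nonneg (sub_mul_self_nonneg_of_effect (h0 L) (h1 L))
      (rejectBefore t L)
    rw [← sub_nonneg]
    convert add_nonneg e e using 1
    simp only [acceptAt, rejectBefore, star_mul, star_sub, hA, star_one]
    noncomm_ring

theorem sum_acceptAt_le (h0 : ∀ k, 0 ≤ t k) (h1 : ∀ k, t k ≤ 1) (L : ℕ) :
    ∑ k ∈ Finset.range L, star (acceptAt t k) * acceptAt t k ≤ 1 :=
  le_trans (le_add_of_nonneg_right (star_mul_self_nonneg _))
    (sum_acceptAt_add_rejectBefore_le h0 h1 L)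

/-- Sequential decoding of one part: there are measurement operators with total weight at most one
such that the operator `k` is good on states that pass the test `k` and fail the others. -/
theorem exists_sequentialBound_family {L : ℕ} (t : Fin L → R) (h0 : ∀ k, 0 ≤ t k)
    (h1 : ∀ k, t k ≤ 1) :
    ∃ K : Fin L → R, ∑ k, star (K k) * K k ≤ 1 ∧
      ∀ k, SequentialBound (K k) ((∑ j with j < k, t j) + (1 - t k)) := by
  let s : ℕ → R := fun k => if h : k < L then t ⟨k, h⟩ else 0
  have hs : ∀ k : Fin L, s k = t k := fun k => by simp [s]
  have s0 : ∀ k, 0 ≤ s k := fun k => by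
    by_cases h : k < L
    · simpa [s, h] using h0 _
    · simp [s, h]
  have s1 : ∀ k, s k ≤ 1 := fun k => by
    by_cases h : k < L
    · simpa [s, h] using h1 _
    · simp [s, h]
  refine ⟨fun k => acceptAt s k, ?_, fun k => ?_⟩
  · rw [Fin.sum_univ_eq_sum_range (fun k => star (acceptAt s k) * acceptAt s k)]
    exact sum_acceptAt_le s0 s1 L
  · convert SequentialBound.acceptAt s0 s1 (k : ℕ) using 2
    · have : Finset.range (k : ℕ) = (Finset.univ.filter (· < k)).map Fin.valEmbedding := by
        ext j
        simp only [Finset.mem_range, Finset.mem_map, Finset.mem_filter, Finset.mem_univ, true_and,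
          Fin.valEmbedding_apply]
        exact ⟨fun h => ⟨⟨j, h.trans k.2⟩, h, rfl⟩, fun ⟨a, ha, e⟩ => e ▸ ha⟩
      rw [this, Finset.sum_map]
      exact Finset.sum_congr rfl fun j _ => (hs j).symm
    · rw [hs]

theorem star_mul_mul_le_of_le_one {A K : R} (h : A ≤ 1) : star K * A * K ≤ star K * K := by
  simpa using star_left_conjugate_le_conjugate h K

/-- Successive decoding of three parts. -/
theorem exists_successive_family {L₀ L₁ L₂ : ℕ} (t₀ : Fin L₀ → R) (t₁ : Fin L₀ → Fin L₁ → R)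
    (t₂ : Fin L₀ → Fin L₁ → Fin L₂ → R)
    (h₀ : ∀ a, 0 ≤ t₀ a ∧ t₀ a ≤ 1) (h₁ : ∀ a b, 0 ≤ t₁ a b ∧ t₁ a b ≤ 1)
    (h₂ : ∀ a b c, 0 ≤ t₂ a b c ∧ t₂ a b c ≤ 1) :
    ∃ E : Fin L₀ × Fin L₁ × Fin L₂ → R, (∀ k, 0 ≤ E k) ∧ ∑ k, E k ≤ 1 ∧
      ∀ a b c, 1 - E (a, b, c) ≤ 4 * (((∑ j with j < a, t₀ j) + (1 - t₀ a))
        + (((∑ j with j < b, t₁ a j) + (1 - t₁ a b))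
        + ((∑ j with j < c, t₂ a b j) + (1 - t₂ a b c)))) := by
  obtain ⟨K₀, hK₀, hB₀⟩ := exists_sequentialBound_family t₀ (fun k => (h₀ k).1) fun k => (h₀ k).2
  choose K₁ hK₁ hB₁ using fun a => exists_sequentialBound_family (t₁ a) (fun k => (h₁ a k).1)
    fun k => (h₁ a k).2
  choose K₂ hK₂ hB₂ using fun a b => exists_sequentialBound_family (t₂ a b)
    (fun k => (h₂ a b k).1) fun k => (h₂ a b k).2
  refine ⟨fun k => star (K₂ k.1 k.2.1 k.2.2 * (K₁ k.1 k.2.1 * K₀ k.1)) *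
    (K₂ k.1 k.2.1 k.2.2 * (K₁ k.1 k.2.1 * K₀ k.1)), fun k => star_mul_self_nonneg _, ?_, ?_⟩
  · simp only [Fintype.sum_prod_type]
    -- The total weight is summed from the last stage inwards: each inner sum is a conjugate of an
    -- operator at most `1`.
    have e2 : ∀ a b, ∑ c, star (K₂ a b c * (K₁ a b * K₀ a)) * (K₂ a b c * (K₁ a b * K₀ a)) ≤
        star (K₁ a b * K₀ a) * (K₁ a b * K₀ a) := fun a b => by
      refine le_trans (le_of_eq ?_) (star_mul_mul_le_of_le_one (hK₂ a b))
      rw [Finset.mul_sum, Finset.sum_mul]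
      simp only [star_mul, mul_assoc]
    have e1 : ∀ a, ∑ b, star (K₁ a b * K₀ a) * (K₁ a b * K₀ a) ≤ star (K₀ a) * K₀ a := fun a => by
      refine le_trans (le_of_eq ?_) (star_mul_mul_le_of_le_one (hK₁ a))
      rw [Finset.mul_sum, Finset.sum_mul]
      simp only [star_mul, mul_assoc]
    exact le_trans (Finset.sum_le_sum fun a _ =>
      (Finset.sum_le_sum fun b _ => e2 a b).trans (e1 a)) hK₀
  · intro a b c
    have := ((hB₂ a b c).mul ((hB₁ a b).mul (hB₀ a))).one_sub_star_mul_self_le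
    simpa only [add_assoc] using this

/-- The test that accepts if two effects are passed one after the other. -/
theorem one_sub_conj_le {P Q : R} (hP0 : 0 ≤ P) (hP1 : P ≤ 1) (hQ0 : 0 ≤ Q) (hQ1 : Q ≤ 1)
    (hQ : Q * Q = Q) : 1 - P * Q * P ≤ 4 * ((1 - P) + (1 - Q)) := by
  have := ((SequentialBound.of_effect hQ0 hQ1).mul
    (SequentialBound.of_effect hP0 hP1)).one_sub_star_mul_self_le
  have hP : star P = P := (IsSelfAdjoint.of_nonneg hP0).star_eq
  have hQs : star Q = Q := (IsSelfAdjoint.of_nonneg hQ0).star_eq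
  rw [star_mul, hP, hQs] at this
  have e : P * Q * (Q * P) = P * Q * P := by
    rw [mul_assoc, ← mul_assoc Q, hQ, mul_assoc]
  rwa [e] at this

theorem conj_effect {P Q : R} (hP0 : 0 ≤ P) (hP1 : P ≤ 1) (hQ0 : 0 ≤ Q) (hQ1 : Q ≤ 1) :
    0 ≤ P * Q * P ∧ P * Q * P ≤ 1 := by
  have hP : star P = P := (IsSelfAdjoint.of_nonneg hP0).star_eq
  have a := star_left_conjugate_nonneg hQ0 P
  have b := star_left_conjugate_le_conjugate hQ1 P
  rw [hP] at a b
  refine ⟨a, b.trans ?_⟩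
  rw [mul_one]
  exact (sub_nonneg.1 (sub_mul_self_nonneg_of_effect hP0 hP1)).trans hP1

end Sequential

open scoped MatrixOrder Matrix Kronecker ComplexOrder
open Matrix Filter Topology

/-! ### Expectations of observables -/

section Expectation

variable {K : Type*} [Fintype K]

/-- The expectation of the observable `A` in the state `ρ`. -/
def expect (ρ A : Matrix K K ℂ) : ℝ := (A * ρ).trace.re

theorem expect_add (ρ A A' : Matrix K K ℂ) : expect ρ (A + A') = expect ρ A + expect ρ A' := by
  simp [expect, add_mul]

theorem expect_sub (ρ A A' : Matrix K K ℂ) : expect ρ (A - A') = expect ρ A - expect ρ A' := by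
  simp [expect, sub_mul]

theorem expect_sum {ι : Type*} (ρ : Matrix K K ℂ) (s : Finset ι) (A : ι → Matrix K K ℂ) :
    expect ρ (∑ i ∈ s, A i) = ∑ i ∈ s, expect ρ (A i) := by
  simp [expect, Finset.sum_mul, trace_sum]

theorem expect_four_mul [DecidableEq K] (ρ A : Matrix K K ℂ) :
    expect ρ (4 * A) = 4 * expect ρ A := by
  have : (4 : Matrix K K ℂ) * A = A + A + A + A := by noncomm_ring
  rw [this]
  simp only [expect_add]
  ring

theorem expect_nonneg {ρ A : Matrix K K ℂ} (hρ : ρ.PosSemidef) (hA : 0 ≤ A) : 0 ≤ expect ρ A := by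
  classical
  obtain ⟨C, rfl⟩ := CStarAlgebra.nonneg_iff_eq_star_mul_self.1 hρ.nonneg
  have h := (nonneg_iff_posSemidef.1 hA).mul_mul_conjTranspose_same C
  have h2 := h.trace_nonneg
  have : (A * (star C * C)).trace = (C * A * Cᴴ).trace := by
    rw [← mul_assoc, trace_mul_comm, star_eq_conjTranspose, mul_assoc]
  rw [expect, this]
  exact (Complex.le_def.1 h2).1

theorem expect_mono {ρ A A' : Matrix K K ℂ} (hρ : ρ.PosSemidef) (hA : A ≤ A') :
    expect ρ A ≤ expect ρ A' := by
  have := expect_nonneg hρ (sub_nonneg.2 hA)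
  rw [expect_sub] at this
  linarith

theorem expect_linear_state {ι : Type*} (s : Finset ι) (w : ι → ℝ) (ρ : ι → Matrix K K ℂ)
    (A : Matrix K K ℂ) :
    expect (∑ i ∈ s, (w i : ℂ) • ρ i) A = ∑ i ∈ s, w i * expect (ρ i) A := by
  simp [expect, Finset.mul_sum, trace_sum]

end Expectation

/-! ### Spectral projections -/

section Spectral

variable {K : Type*} [Fintype K] [DecidableEq K]

/-- The projection onto the span of those columns of `U` whose label lies in `s`. -/
def columnProj (U : Matrix K K ℂ) (s : Finset K) : Matrix K K ℂ :=
  U * diagonal (fun b => if b ∈ s then 1 else 0) * Uᴴ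

variable {U : Matrix K K ℂ}

theorem conj_diagonal_mul (hU : Uᴴ * U = 1) (d e : K → ℂ) :
    (U * diagonal d * Uᴴ) * (U * diagonal e * Uᴴ) = U * diagonal (fun b => d b * e b) * Uᴴ := by
  have : (U * diagonal d * Uᴴ) * (U * diagonal e * Uᴴ)
      = U * diagonal d * (Uᴴ * U) * diagonal e * Uᴴ := by noncomm_ring
  rw [this, hU, mul_one, mul_assoc U, diagonal_mul_diagonal]

theorem trace_conj_diagonal (hU : Uᴴ * U = 1) (d : K → ℂ) : (U * diagonal d * Uᴴ).trace = ∑ b, d b := by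
  rw [trace_mul_comm, ← mul_assoc, hU, one_mul, trace_diagonal]

theorem conj_diagonal_nonneg {d : K → ℂ} (hd : ∀ b, 0 ≤ d b) : 0 ≤ U * diagonal d * Uᴴ :=
  ((PosSemidef.diagonal (d := d) hd).mul_mul_conjTranspose_same U).nonneg

theorem columnProj_nonneg (s : Finset K) : 0 ≤ columnProj U s :=
  conj_diagonal_nonneg fun b => by split_ifs <;> simp

theorem one_sub_columnProj (hU : Uᴴ * U = 1) (s : Finset K) : 1 - columnProj U s = columnProj U sᶜ := by
  have hU' : U * Uᴴ = 1 := mul_eq_one_comm.1 hU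
  rw [sub_eq_iff_eq_add, columnProj, columnProj, ← add_mul, ← mul_add, diagonal_add]
  have : (fun b => (if b ∈ sᶜ then (1 : ℂ) else 0) + if b ∈ s then 1 else 0) = fun _ => 1 := by
    ext b
    by_cases h : b ∈ s <;> simp [h]
  rw [this, diagonal_one, mul_one, hU']

theorem columnProj_le_one (hU : Uᴴ * U = 1) (s : Finset K) : columnProj U s ≤ 1 := by
  rw [← sub_nonneg, one_sub_columnProj hU]
  exact columnProj_nonneg _

theorem columnProj_mul_self (hU : Uᴴ * U = 1) (s : Finset K) :
    columnProj U s * columnProj U s = columnProj U s := by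
  rw [columnProj, conj_diagonal_mul hU]
  congr 3
  ext b
  split_ifs <;> simp

theorem expect_one_sub_columnProj (hU : Uᴴ * U = 1) (s : Finset K) (d : K → ℝ) :
    expect (U * diagonal (fun b => (d b : ℂ)) * Uᴴ) (1 - columnProj U s)
      = ∑ b, if b ∈ s then 0 else d b := by
  rw [one_sub_columnProj hU, expect, columnProj, conj_diagonal_mul hU, trace_conj_diagonal hU,
    Complex.re_sum]
  refine Finset.sum_congr rfl fun b _ => ?_
  by_cases h : b ∈ s <;> simp [h]

theorem trace_columnProj (hU : Uᴴ * U = 1) (s : Finset K) : (columnProj U s).trace = s.card := by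
  rw [columnProj, trace_conj_diagonal hU]
  simp

theorem columnProj_conj_le (hU : Uᴴ * U = 1) (s : Finset K) (d : K → ℝ) {τ : ℝ}
    (hd : ∀ b ∈ s, d b ≤ τ)
    (hτ : 0 ≤ τ) :
    columnProj U s * (U * diagonal (fun b => (d b : ℂ)) * Uᴴ) * columnProj U s ≤
      (τ : ℂ) • 1 := by
  have hU' : U * Uᴴ = 1 := mul_eq_one_comm.1 hU
  have h3 : (τ : ℂ) • 1 = U * diagonal (fun _ => (τ : ℂ)) * Uᴴ := by
    rw [← smul_one_eq_diagonal, mul_smul_comm, mul_one, smul_mul_assoc, hU']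
  rw [columnProj, conj_diagonal_mul hU, conj_diagonal_mul hU, h3, ← sub_nonneg, ← sub_mul,
    ← mul_sub, diagonal_sub]
  refine conj_diagonal_nonneg fun b => ?_
  by_cases h : b ∈ s
  · have : (0 : ℂ) ≤ ((τ - d b : ℝ) : ℂ) := Complex.zero_le_real.2 (sub_nonneg.2 (hd b h))
    simpa [h] using this
  · have : (0 : ℂ) ≤ (τ : ℂ) := Complex.zero_le_real.2 hτ
    simpa [h] using this

theorem expect_conj_comm (ρ P Q : Matrix K K ℂ) :
    expect ρ (P * Q * P) = expect Q (P * ρ * P) := by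
  have : (P * Q * P * ρ).trace = (P * ρ * P * Q).trace := by
    rw [show P * Q * P * ρ = (P * Q) * (P * ρ) by simp only [mul_assoc], trace_mul_comm]
    simp only [mul_assoc]
  rw [expect, expect, this]

/-- A state with eigenvalues at most `τ` on the range of a spectral projection `P` assigns the
expectation at most `τ * rank Q` to `P * Q * P`. -/
theorem expect_conj_columnProj_le (hU : Uᴴ * U = 1) {V : Matrix K K ℂ} (hV : Vᴴ * V = 1)
    (s t : Finset K) (d : K → ℝ)
    {τ : ℝ} (hd : ∀ b ∈ s, d b ≤ τ) (hτ : 0 ≤ τ) :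
    expect (U * diagonal (fun b => (d b : ℂ)) * Uᴴ)
      (columnProj U s * columnProj V t * columnProj U s)
      ≤ τ * t.card := by
  rw [expect_conj_comm]
  refine (expect_mono (nonneg_iff_posSemidef.1 (columnProj_nonneg t))
    (columnProj_conj_le hU s d hd hτ)).trans (le_of_eq ?_)
  rw [expect, smul_mul_assoc, one_mul, trace_smul, trace_columnProj hV]
  simp

end Spectral

/-! ### Tensor powers -/

section Tensor

variable {n : ℕ} {B : Type*}

/-- The tensor product of `n` matrices. -/
def tensor (M : Fin n → Matrix B B ℂ) : Matrix (Fin n → B) (Fin n → B) ℂ :=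
  Matrix.of fun b b' => ∏ i, M i (b i) (b' i)

theorem tensor_conjTranspose (M : Fin n → Matrix B B ℂ) :
    (tensor M)ᴴ = tensor fun i => (M i)ᴴ := by
  ext b b'
  simp [tensor, conjTranspose_apply]

theorem tensor_diagonal [DecidableEq B] (d : Fin n → B → ℂ) :
    tensor (fun i => diagonal (d i)) = diagonal fun b => ∏ i, d i (b i) := by
  ext b b'
  by_cases h : b = b'
  · subst h
    simp [tensor]
  · rw [diagonal_apply_ne _ h]
    obtain ⟨i, hi⟩ := Function.ne_iff.1 h
    exact Finset.prod_eq_zero (Finset.mem_univ i) (diagonal_apply_ne _ hi)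

theorem tensor_one [DecidableEq B] : tensor (fun _ : Fin n => (1 : Matrix B B ℂ)) = 1 := by
  simp only [← diagonal_one]
  rw [tensor_diagonal]
  simp

variable [Fintype B] [DecidableEq B]

theorem tensor_mul (M M' : Fin n → Matrix B B ℂ) :
    tensor M * tensor M' = tensor fun i => M i * M' i := by
  ext b b'
  simp only [tensor, mul_apply, of_apply, ← Finset.prod_mul_distrib]
  rw [Finset.prod_univ_sum, Fintype.piFinset_univ]

theorem tensor_posSemidef {M : Fin n → Matrix B B ℂ} (h : ∀ i, (M i).PosSemidef) :
    (tensor M).PosSemidef := by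
  choose C hC using fun i => CStarAlgebra.nonneg_iff_eq_star_mul_self.1 (h i).nonneg
  have : tensor M = (tensor C)ᴴ * tensor C := by
    rw [tensor_conjTranspose, tensor_mul]
    exact congrArg tensor (funext hC)
  rw [this]
  exact posSemidef_conjTranspose_mul_self _

variable {σ : Fin n → Matrix B B ℂ} (h : ∀ i, (σ i).IsHermitian)

/-- The tensor product of the unitaries that diagonalize the factors. -/
def tensorEigenbasis : Matrix (Fin n → B) (Fin n → B) ℂ :=
  tensor fun i => ((h i).eigenvectorUnitary : Matrix B B ℂ)

theorem tensorEigenbasis_unitary : (tensorEigenbasis h)ᴴ * tensorEigenbasis h = 1 := by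
  rw [tensorEigenbasis, tensor_conjTranspose, tensor_mul, ← tensor_one]
  congr 1
  ext1 i
  exact Unitary.coe_star_mul_self _

theorem tensor_eq_conj_diagonal : tensor σ = tensorEigenbasis h *
    diagonal (fun b => ((∏ i, (h i).eigenvalues (b i) : ℝ) : ℂ)) * (tensorEigenbasis h)ᴴ := by
  have : diagonal (fun b => ((∏ i, (h i).eigenvalues (b i) : ℝ) : ℂ)) =
      tensor fun i => diagonal fun a => (((h i).eigenvalues a : ℝ) : ℂ) := by
    rw [tensor_diagonal]
    simp
  rw [this, tensorEigenbasis, tensor_conjTranspose, tensor_mul, tensor_mul]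
  congr 1
  ext1 i
  conv_lhs => rw [(h i).spectral_theorem]
  rfl

end Tensor

/-! ### The law of large numbers with exponential rate -/

section Chernoff

variable {α : Type*} [Fintype α] {w : α → ℝ}

theorem exists_sum_mul_exp_lt_one (hw0 : ∀ a, 0 ≤ w a) (hw1 : ∑ a, w a = 1) (u : α → ℝ)
    (hu : ∑ a, w a * u a < 0) : ∃ t > 0, ∑ a, w a * Real.exp (t * u a) < 1 := by
  set δ := -∑ a, w a * u a with hδ
  have hδ0 : 0 < δ := by linarith
  -- `M` dominates `1`, `δ` and every `|u a|`, so `t * M ≤ 1` and `exp x ≤ 1 + x + x ^ 2` applies to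
  -- `t * u a`. With `t = δ / (2 * M ^ 2)` the average is at most `1 - t * δ / 2`.
  set M := 1 + δ + ∑ a, |u a| with hM
  have hs : 0 ≤ ∑ a, |u a| := Finset.sum_nonneg fun a _ => abs_nonneg _
  have hM1 : 1 ≤ M := by linarith
  have hMδ : δ ≤ M := by linarith
  have hMu : ∀ a, |u a| ≤ M := fun a => by
    have := Finset.single_le_sum (f := fun a => |u a|) (fun a _ => abs_nonneg _) (Finset.mem_univ a)
    linarith
  have ht : 0 < δ / (2 * M ^ 2) := by positivity
  refine ⟨δ / (2 * M ^ 2), ht, ?_⟩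
  set t := δ / (2 * M ^ 2) with htd
  have htM : t * M ^ 2 = δ / 2 := by rw [htd]; field_simp
  have htM1 : t * M ≤ 1 := by
    have : t * M * M ≤ 1 * M := by nlinarith
    exact le_of_mul_le_mul_right this (by linarith)
  have hexp : ∀ a, Real.exp (t * u a) ≤ 1 + t * u a + (t * M) ^ 2 := fun a => by
    have h1 : |t * u a| ≤ t * M := by
      rw [abs_mul, abs_of_pos ht]
      exact mul_le_mul_of_nonneg_left (hMu a) ht.le
    have h2 := (abs_le.1 (Real.abs_exp_sub_one_sub_id_le (h1.trans htM1))).2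
    have h3 : (t * u a) ^ 2 ≤ (t * M) ^ 2 := sq_le_sq' (by linarith [(abs_le.1 h1).1])
      (abs_le.1 h1).2
    linarith
  have h4 : ∑ a, w a * Real.exp (t * u a) ≤ ∑ a, w a * (1 + t * u a + (t * M) ^ 2) :=
    Finset.sum_le_sum fun a _ => mul_le_mul_of_nonneg_left (hexp a) (hw0 a)
  have h5 : ∑ a, w a * (1 + t * u a + (t * M) ^ 2) = 1 - t * δ + (t * M) ^ 2 := by
    have : ∀ a, w a * (1 + t * u a + (t * M) ^ 2)
        = w a * (1 + (t * M) ^ 2) + t * (w a * u a) := fun a => by ring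
    simp only [this, Finset.sum_add_distrib, ← Finset.sum_mul, ← Finset.mul_sum, hw1]
    rw [hδ]
    ring
  have h6 : (t * M) ^ 2 = t * (δ / 2) := by rw [← htM]; ring
  nlinarith [mul_pos ht hδ0]

/-- Chernoff: the indicator is dominated by a product of exponentials of the centred letters, whose
expectation factorizes. -/
theorem exists_sum_deviation_le_pow (hw0 : ∀ a, 0 ≤ w a) (hw1 : ∑ a, w a = 1) (g : α → ℝ)
    {δ : ℝ} (hδ : 0 < δ) : ∃ c, 0 ≤ c ∧ c < 1 ∧ ∀ n : ℕ, ∑ a : Fin n → α, (∏ i, w (a i)) *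
      (if n * (∑ a, w a * g a) + n * δ ≤ ∑ i, g (a i) then 1 else 0) ≤ c ^ n := by
  set μ := ∑ a, w a * g a with hμ
  have hu : ∑ a, w a * (g a - μ - δ) < 0 := by
    have : ∀ a, w a * (g a - μ - δ) = w a * g a - w a * (μ + δ) := fun a => by ring
    simp only [this, Finset.sum_sub_distrib, ← Finset.sum_mul, hw1, ← hμ]
    linarith
  obtain ⟨t, ht, hc⟩ := exists_sum_mul_exp_lt_one hw0 hw1 _ hu
  refine ⟨_, Finset.sum_nonneg fun a _ => mul_nonneg (hw0 a) (Real.exp_pos _).le, hc, fun n => ?_⟩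
  rw [Fintype.sum_pow]
  refine Finset.sum_le_sum fun a _ => ?_
  rw [Finset.prod_mul_distrib, ← Real.exp_sum]
  refine mul_le_mul_of_nonneg_left ?_ (Finset.prod_nonneg fun i _ => hw0 _)
  split_ifs with h
  · refine Real.one_le_exp ?_
    rw [← Finset.mul_sum]
    refine mul_nonneg ht.le ?_
    simp only [Finset.sum_sub_distrib, Finset.sum_const, Finset.card_univ, Fintype.card_fin,
      nsmul_eq_mul]
    linarith
  · exact (Real.exp_pos _).le

end Chernoff

/-! ### One-sided equipartition for the spectra of product states. -/

section Equipartition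

variable {Z B : Type*} [Fintype Z] [Fintype B] {P : Z → ℝ} {lam : Z → B → ℝ}

theorem sum_pair_prod (n : ℕ) (f : Z → B → ℝ) (F : (Fin n → Z) → (Fin n → B) → ℝ) :
    ∑ a : Fin n → Z × B, (∏ i, P (a i).1 * f (a i).1 (a i).2) *
      F (fun i => (a i).1) (fun i => (a i).2) =
    ∑ z : Fin n → Z, (∏ i, P (z i)) * ∑ b : Fin n → B, (∏ i, f (z i) (b i)) * F z b := by
  simp only [Finset.mul_sum]
  rw [← Fintype.sum_prod_type']
  refine Fintype.sum_equiv (Equiv.arrowProdEquivProdArrow (Fin n) (fun _ => Z) fun _ => B) _ _ ?_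
  intro a
  simp only [Equiv.arrowProdEquivProdArrow, Equiv.coe_fn_mk, Finset.prod_mul_distrib, mul_assoc]

/-- The deviation bound for `log (lam z b)` when the pair `(z, b)` has probability `P z * lam z b`;
the mean is minus the conditional entropy. -/
theorem exists_upper_equipartition (hP0 : ∀ z, 0 ≤ P z) (hP1 : ∑ z, P z = 1)
    (hl0 : ∀ z b, 0 ≤ lam z b) (hl1 : ∀ z, ∑ b, lam z b = 1) {δ : ℝ} (hδ : 0 < δ) :
    ∃ c, 0 ≤ c ∧ c < 1 ∧ ∀ n : ℕ,
    ∑ z : Fin n → Z, (∏ i, P (z i)) * ∑ b : Fin n → B,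
      (if ∏ i, lam (z i) (b i) ≤
        Real.exp (-(n * ((∑ z, P z * ∑ b, Real.negMulLog (lam z b)) - δ)))
        then 0 else ∏ i, lam (z i) (b i)) ≤ c ^ n := by
  obtain ⟨c, c0, c1, hc⟩ := exists_sum_deviation_le_pow (α := Z × B)
    (w := fun a => P a.1 * lam a.1 a.2) (fun a => mul_nonneg (hP0 _) (hl0 _ _))
    (by simp [Fintype.sum_prod_type, ← Finset.mul_sum, hl1, hP1])
    (fun a => Real.log (lam a.1 a.2)) hδ
  refine ⟨c, c0, c1, fun n => le_trans ?_ (hc n)⟩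
  have hμ : ∑ a : Z × B, P a.1 * lam a.1 a.2 * Real.log (lam a.1 a.2)
      = -∑ z, P z * ∑ b, Real.negMulLog (lam z b) := by
    simp [Fintype.sum_prod_type, Real.negMulLog, Finset.mul_sum, mul_assoc]
  rw [hμ]
  set H := ∑ z, P z * ∑ b, Real.negMulLog (lam z b)
  refine le_of_le_of_eq ?_ (sum_pair_prod n lam fun z b =>
    if n * -H + n * δ ≤ ∑ i, Real.log (lam (z i) (b i)) then 1 else 0).symm
  refine Finset.sum_le_sum fun z _ => mul_le_mul_of_nonneg_left (Finset.sum_le_sum fun b _ => ?_)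
    (Finset.prod_nonneg fun i _ => hP0 _)
  have hp : 0 ≤ ∏ i, lam (z i) (b i) := Finset.prod_nonneg fun i _ => hl0 _ _
  split_ifs with h1 h2 h2
  · simpa using hp
  · simp
  · simp
  · exfalso
    apply h2
    -- Positivity of the product excludes zero eigenvalues, for which `Real.log` takes the default
    -- value `0`.
    have hpos := (Real.exp_pos _).trans (not_le.1 h1)
    rw [← Real.log_prod fun i hi => Finset.prod_ne_zero_iff.1 hpos.ne' i hi]
    refine le_of_eq_of_le ?_ ((Real.le_log_iff_exp_le hpos).2 (not_le.1 h1).le)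
    ring

theorem exists_lower_equipartition (hP0 : ∀ z, 0 ≤ P z) (hP1 : ∑ z, P z = 1)
    (hl0 : ∀ z b, 0 ≤ lam z b) (hl1 : ∀ z, ∑ b, lam z b = 1) {δ : ℝ} (hδ : 0 < δ) :
    ∃ c, 0 ≤ c ∧ c < 1 ∧ ∀ n : ℕ,
    ∑ z : Fin n → Z, (∏ i, P (z i)) * ∑ b : Fin n → B,
      (if Real.exp (-(n * ((∑ z, P z * ∑ b, Real.negMulLog (lam z b)) + δ))) ≤
        ∏ i, lam (z i) (b i)
        then 0 else ∏ i, lam (z i) (b i)) ≤ c ^ n := by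
  obtain ⟨c, c0, c1, hc⟩ := exists_sum_deviation_le_pow (α := Z × B)
    (w := fun a => P a.1 * lam a.1 a.2) (fun a => mul_nonneg (hP0 _) (hl0 _ _))
    (by simp [Fintype.sum_prod_type, ← Finset.mul_sum, hl1, hP1])
    (fun a => -Real.log (lam a.1 a.2)) hδ
  refine ⟨c, c0, c1, fun n => le_trans ?_ (hc n)⟩
  have hμ : ∑ a : Z × B, P a.1 * lam a.1 a.2 * -Real.log (lam a.1 a.2)
      = ∑ z, P z * ∑ b, Real.negMulLog (lam z b) := by
    simp [Fintype.sum_prod_type, Real.negMulLog, Finset.mul_sum, mul_assoc]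
  rw [hμ]
  set H := ∑ z, P z * ∑ b, Real.negMulLog (lam z b)
  refine le_of_le_of_eq ?_ (sum_pair_prod n lam fun z b =>
    if n * H + n * δ ≤ ∑ i, -Real.log (lam (z i) (b i)) then 1 else 0).symm
  refine Finset.sum_le_sum fun z _ => mul_le_mul_of_nonneg_left (Finset.sum_le_sum fun b _ => ?_)
    (Finset.prod_nonneg fun i _ => hP0 _)
  have hp : 0 ≤ ∏ i, lam (z i) (b i) := Finset.prod_nonneg fun i _ => hl0 _ _
  split_ifs with h1 h2 h2
  · simpa using hp
  · simp
  · simp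
  -- Only products of positive eigenvalues matter: a vanishing product contributes nothing to the
  -- left side.
  · rw [mul_zero]
    by_contra h3
    have hpos := not_le.1 h3
    apply h2
    rw [Finset.sum_neg_distrib,
      ← Real.log_prod fun i hi => Finset.prod_ne_zero_iff.1 hpos.ne' i hi]
    have := (Real.log_lt_iff_lt_exp hpos).2 (not_le.1 h1)
    linarith

end Equipartition

/-! ### Tests from typical projections -/

section Test

variable {n : ℕ} {B : Type*} [Fintype B] [DecidableEq B] {σ ω : Fin n → Matrix B B ℂ}

/-- The spectral projection of the tensor product of the `σ i` onto the eigenvalues at most `τ`. -/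
def upperProj (h : ∀ i, (σ i).IsHermitian) (τ : ℝ) : Matrix (Fin n → B) (Fin n → B) ℂ :=
  columnProj (tensorEigenbasis h) {b | ∏ i, (h i).eigenvalues (b i) ≤ τ}

/-- The spectral projection of the tensor product of the `σ i` onto the eigenvalues at least
`τ`. -/
def lowerProj (h : ∀ i, (σ i).IsHermitian) (τ : ℝ) : Matrix (Fin n → B) (Fin n → B) ℂ :=
  columnProj (tensorEigenbasis h) {b | τ ≤ ∏ i, (h i).eigenvalues (b i)}

/-- The test for `⨂ ω i` against `⨂ σ i`. -/
def typicalTest (h : ∀ i, (σ i).IsHermitian) (h' : ∀ i, (ω i).IsHermitian) (τ τ' : ℝ) :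
    Matrix (Fin n → B) (Fin n → B) ℂ :=
  upperProj h τ * lowerProj h' τ' * upperProj h τ

theorem upperProj_congr {σ₁ : Fin n → Matrix B B ℂ} (h : ∀ i, (σ i).IsHermitian)
    (h₁ : ∀ i, (σ₁ i).IsHermitian) (τ : ℝ) (e : σ = σ₁) : upperProj h τ = upperProj h₁ τ := by
  subst e
  rfl

theorem lowerProj_congr {σ₁ : Fin n → Matrix B B ℂ} (h : ∀ i, (σ i).IsHermitian)
    (h₁ : ∀ i, (σ₁ i).IsHermitian) (τ : ℝ) (e : σ = σ₁) : lowerProj h τ = lowerProj h₁ τ := by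
  subst e
  rfl

theorem typicalTest_congr {σ₁ ω₁ : Fin n → Matrix B B ℂ} (h : ∀ i, (σ i).IsHermitian)
    (h' : ∀ i, (ω i).IsHermitian) (h₁ : ∀ i, (σ₁ i).IsHermitian) (h₁' : ∀ i, (ω₁ i).IsHermitian)
    (τ τ' : ℝ) (e : σ = σ₁) (e' : ω = ω₁) : typicalTest h h' τ τ' = typicalTest h₁ h₁' τ τ' := by
  rw [typicalTest, typicalTest, upperProj_congr h h₁ τ e, lowerProj_congr h' h₁' τ' e']

variable (h : ∀ i, (σ i).IsHermitian) (h' : ∀ i, (ω i).IsHermitian) (τ τ' : ℝ)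

theorem typicalTest_effect : 0 ≤ typicalTest h h' τ τ' ∧ typicalTest h h' τ τ' ≤ 1 :=
  conj_effect (columnProj_nonneg _) (columnProj_le_one (tensorEigenbasis_unitary h) _)
    (columnProj_nonneg _) (columnProj_le_one (tensorEigenbasis_unitary h') _)

theorem one_sub_typicalTest_le :
    1 - typicalTest h h' τ τ' ≤ 4 * ((1 - upperProj h τ) + (1 - lowerProj h' τ')) :=
  one_sub_conj_le (columnProj_nonneg _) (columnProj_le_one (tensorEigenbasis_unitary h) _)
    (columnProj_nonneg _) (columnProj_le_one (tensorEigenbasis_unitary h') _)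
    (columnProj_mul_self (tensorEigenbasis_unitary h') _)

theorem expect_one_sub_upperProj : expect (tensor σ) (1 - upperProj h τ) =
    ∑ b : Fin n → B, if ∏ i, (h i).eigenvalues (b i) ≤ τ then 0
      else ∏ i, (h i).eigenvalues (b i) := by
  rw [tensor_eq_conj_diagonal h, upperProj, expect_one_sub_columnProj (tensorEigenbasis_unitary h)]
  simp

theorem expect_one_sub_lowerProj : expect (tensor σ) (1 - lowerProj h τ) =
    ∑ b : Fin n → B, if τ ≤ ∏ i, (h i).eigenvalues (b i) then 0
      else ∏ i, (h i).eigenvalues (b i) := by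
  rw [tensor_eq_conj_diagonal h, lowerProj, expect_one_sub_columnProj (tensorEigenbasis_unitary h)]
  simp

theorem sum_eigenvalues_eq_one {M : Matrix B B ℂ} (hM : M.IsHermitian) (ht : M.trace = 1) :
    ∑ b, hM.eigenvalues b = 1 := by
  have := hM.trace_eq_sum_eigenvalues
  rw [ht] at this
  refine Complex.ofReal_injective ?_
  simpa using this.symm

/-- The lower projection has rank at most `1 / τ'`, because the eigenvalues of `tensor ω` sum to
one. -/
theorem expect_typicalTest_le (hω : ∀ i, (ω i).PosSemidef) (hωt : ∀ i, (ω i).trace = 1)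
    (hτ : 0 ≤ τ) (hτ' : 0 < τ') : expect (tensor σ) (typicalTest h h' τ τ') ≤ τ / τ' := by
  have h1 := expect_conj_columnProj_le (tensorEigenbasis_unitary h) (tensorEigenbasis_unitary h')
    {b | ∏ i, (h i).eigenvalues (b i) ≤ τ} {b | τ' ≤ ∏ i, (h' i).eigenvalues (b i)}
    (fun b => ∏ i, (h i).eigenvalues (b i)) (τ := τ) (fun b hb => by simpa using hb) hτ
  rw [← tensor_eq_conj_diagonal h] at h1
  refine h1.trans ?_
  rw [div_eq_mul_inv]
  refine mul_le_mul_of_nonneg_left ?_ hτ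
  have h0 : ∀ b : Fin n → B, 0 ≤ ∏ i, (h' i).eigenvalues (b i) := fun b =>
    Finset.prod_nonneg fun i _ => by
      rw [show h' i = (hω i).isHermitian from rfl]
      exact (hω i).eigenvalues_nonneg _
  have h2 : ∑ b : Fin n → B, ∏ i, (h' i).eigenvalues (b i) = 1 := by
    rw [← Fintype.piFinset_univ, ← Finset.prod_univ_sum]
    exact Finset.prod_eq_one fun i _ => sum_eigenvalues_eq_one (h' i) (hωt i)
  rw [← one_div, le_div_iff₀ hτ', ← h2, ← nsmul_eq_mul]
  refine (Finset.card_nsmul_le_sum _ _ τ' fun b hb => ?_).trans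
    (Finset.sum_le_univ_sum_of_nonneg h0)
  simpa using hb

end Test

/-! ### Independent random blocks -/

section Resampling

variable {J : Type*} [Fintype J] [DecidableEq J] {α : J → Type*} [∀ j, Fintype (α j)] {n : ℕ}
  {w : ∀ j, α j → ℝ}

/-- The probability of a block of length `n` of families with independent entries. -/
def blockWeight (w : ∀ j, α j → ℝ) (c : Fin n → ∀ j, α j) : ℝ := ∏ i, ∏ j, w j (c i j)

theorem blockWeight_nonneg (h0 : ∀ j a, 0 ≤ w j a) (c : Fin n → ∀ j, α j) :
    0 ≤ blockWeight w c :=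
  Finset.prod_nonneg fun _ _ => Finset.prod_nonneg fun _ _ => h0 _ _

theorem sum_prod_eq_one (h1 : ∀ j, ∑ a, w j a = 1) : ∑ d : ∀ j, α j, ∏ j, w j (d j) = 1 := by
  rw [← Fintype.piFinset_univ, ← Finset.prod_univ_sum]
  exact Finset.prod_eq_one fun j _ => h1 j

theorem sum_blockWeight (h1 : ∀ j, ∑ a, w j a = 1) :
    ∑ c : Fin n → ∀ j, α j, blockWeight w c = 1 := by
  simp only [blockWeight]
  rw [← Fintype.sum_pow (fun d : ∀ j, α j => ∏ j, w j (d j)), sum_prod_eq_one h1, one_pow]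

theorem blockWeight_piecewise_mul (A : Finset J) (c c' : Fin n → ∀ j, α j) :
    blockWeight w (fun i => A.piecewise (c i) (c' i)) *
      blockWeight w (fun i => A.piecewise (c' i) (c i)) = blockWeight w c * blockWeight w c' := by
  simp only [blockWeight, ← Finset.prod_mul_distrib]
  refine Finset.prod_congr rfl fun i _ => Finset.prod_congr rfl fun j _ => ?_
  by_cases h : j ∈ A
  · simp [h]
  · simp [h, mul_comm]

/-- Exchanging the coordinates outside `A` between two independent copies is an involution that
preserves the product weight. -/
theorem sum_blockWeight_resample (h1 : ∀ j, ∑ a, w j a = 1) (A : Finset J)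
    (G : (Fin n → ∀ j, α j) → ℝ) :
    ∑ c, blockWeight w c * G c = ∑ c, blockWeight w c * ∑ c', blockWeight w c' *
      G (fun i => A.piecewise (c i) (c' i)) := by
  let e : (Fin n → ∀ j, α j) × (Fin n → ∀ j, α j) → (Fin n → ∀ j, α j) × (Fin n → ∀ j, α j) :=
    fun x => (fun i => A.piecewise (x.1 i) (x.2 i), fun i => A.piecewise (x.2 i) (x.1 i))
  have he : Function.Involutive e := fun x => by
    refine Prod.ext ?_ ?_ <;> funext i j <;> by_cases h : j ∈ A <;> simp [e, h]
  have h2 : ∑ x : (Fin n → ∀ j, α j) × (Fin n → ∀ j, α j),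
      blockWeight w x.1 * blockWeight w x.2 * G (e x).1 =
      ∑ x : (Fin n → ∀ j, α j) × (Fin n → ∀ j, α j),
        blockWeight w x.1 * blockWeight w x.2 * G x.1 := by
    refine Fintype.sum_equiv he.toPerm _ _ fun x => ?_
    rw [← blockWeight_piecewise_mul A]
    rfl
  simp only [Fintype.sum_prod_type] at h2
  simp only [Finset.mul_sum, ← mul_assoc]
  refine Eq.trans ?_ h2.symm
  refine Finset.sum_congr rfl fun c _ => ?_
  rw [← Finset.sum_mul, ← Finset.mul_sum, sum_blockWeight h1, mul_one]

end Resampling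

/-! ### Random codebooks -/

section Codebook

variable {𝒳 : Part → Type*} [∀ l, Fintype (𝒳 l)] {n : ℕ} {L : Part → ℕ}

/-- A codebook for every part; the time index comes first. -/
abbrev Codebook (𝒳 : Part → Type*) (L : Part → ℕ) (n : ℕ) : Type _ :=
  Fin n → ∀ q : (Σ l, Fin (L l)), 𝒳 q.1

/-- The codewords for the messages `m`. -/
def codewords (c : Codebook 𝒳 L n) (m : ∀ l, Fin (L l)) : Fin n → ∀ l, 𝒳 l :=
  fun i l => c i ⟨l, m l⟩

/-- The probability of a codebook with independent letters of distribution `p`. -/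
def codebookWeight (p : ∀ l, 𝒳 l → ℝ) (c : Codebook 𝒳 L n) : ℝ :=
  blockWeight (fun q : (Σ l, Fin (L l)) => p q.1) c

variable {p : ∀ l, 𝒳 l → ℝ}

theorem sum_codebookWeight_fiber (h1 : ∀ l, ∑ a, p l a = 1) (m : ∀ l, Fin (L l))
    (z : Fin n → ∀ l, 𝒳 l) [DecidableEq (Fin n → ∀ l, 𝒳 l)] :
    ∑ c : Codebook 𝒳 L n with codewords c m = z, codebookWeight p c = blockWeight p z := by
  classical
  -- The fiber is a box: letters of the selected codewords are pinned, all others are free and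
  -- contribute a factor `1`.
  let S : Fin n → ∀ q : (Σ l, Fin (L l)), Finset (𝒳 q.1) :=
    fun i q => if q.2 = m q.1 then {z i q.1} else Finset.univ
  have hS : (Finset.univ.filter fun c : Codebook 𝒳 L n => codewords c m = z) =
      Fintype.piFinset fun i => Fintype.piFinset (S i) := by
    ext c
    simp only [Finset.mem_filter, Finset.mem_univ, true_and, Fintype.mem_piFinset]
    constructor
    · rintro rfl i ⟨l, k⟩
      by_cases h : k = m l
      · subst h
        simp [S, codewords]
      · simp [S, h]
    · intro h
      funext i l
      have := h i ⟨l, m l⟩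
      simpa [S, codewords] using this
  rw [hS]
  simp only [codebookWeight, blockWeight]
  rw [← Finset.prod_univ_sum (fun i => Fintype.piFinset (S i))
    (fun _ (d : ∀ q : (Σ l, Fin (L l)), 𝒳 q.1) => ∏ q, p q.1 (d q))]
  refine Finset.prod_congr rfl fun i _ => ?_
  rw [← Finset.prod_univ_sum (S i) fun q a => p q.1 a, Fintype.prod_sigma]
  refine Finset.prod_congr rfl fun l _ => ?_
  rw [Finset.prod_eq_single (m l)]
  · simp [S]
  · intro k _ hk
    simp [S, hk, h1]
  · simp

theorem sum_codebookWeight_comp (h1 : ∀ l, ∑ a, p l a = 1) (m : ∀ l, Fin (L l))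
    (f : (Fin n → ∀ l, 𝒳 l) → ℝ) :
    ∑ c : Codebook 𝒳 L n, codebookWeight p c * f (codewords c m) = ∑ z, blockWeight p z * f z := by
  classical
  rw [← Finset.sum_fiberwise (s := Finset.univ) (g := fun c : Codebook 𝒳 L n => codewords c m)]
  refine Finset.sum_congr rfl fun z _ => ?_
  rw [← sum_codebookWeight_fiber h1 m z, Finset.sum_mul]
  refine Finset.sum_congr rfl fun c hc => ?_
  rw [(Finset.mem_filter.1 hc).2]

end Codebook

/-! ### Averaged states of blocks -/

section Averaged

variable {𝒳 : Part → Type*} [∀ l, Fintype (𝒳 l)] {B : Type*} [Fintype B] [DecidableEq B]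
  {p : ∀ l, 𝒳 l → ℝ} {ρ : (∀ l, 𝒳 l) → Matrix B B ℂ} {n : ℕ}

theorem averagedState_congr {S : Finset Part} {x x' : ∀ l, 𝒳 l} (h : ∀ l ∈ S, x l = x' l) :
    averagedState p ρ S x = averagedState p ρ S x' := by
  refine Finset.sum_congr rfl fun y _ => ?_
  congr 2
  exact S.piecewise_congr h fun _ _ => rfl

theorem prodDist_nonneg (hp : ∀ l a, 0 ≤ p l a) (x : ∀ l, 𝒳 l) : 0 ≤ prodDist p x :=
  Finset.prod_nonneg fun _ _ => hp _ _

theorem averagedState_posSemidef (hp : ∀ l a, 0 ≤ p l a) (hρ : ∀ x, (ρ x).PosSemidef)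
    (S : Finset Part) (x : ∀ l, 𝒳 l) : (averagedState p ρ S x).PosSemidef :=
  posSemidef_sum _ fun y _ =>
    (hρ _).smul (Complex.zero_le_real.2 (prodDist_nonneg hp y))

theorem averagedState_trace (h1 : ∀ l, ∑ a, p l a = 1) (hρ : ∀ x, (ρ x).trace = 1)
    (S : Finset Part) (x : ∀ l, 𝒳 l) : (averagedState p ρ S x).trace = 1 := by
  rw [averagedState, trace_sum]
  simp only [trace_smul, hρ, smul_eq_mul, mul_one]
  have := sum_prod_eq_one h1
  exact_mod_cast this

theorem tensor_averagedState (S : Finset Part) (z : Fin n → ∀ l, 𝒳 l) :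
    tensor (fun i => averagedState p ρ S (z i)) =
      ∑ y : Fin n → ∀ l, 𝒳 l, (blockWeight p y : ℂ) •
        tensor fun i => ρ (S.piecewise (z i) (y i)) := by
  ext b b'
  simp only [tensor, averagedState, of_apply, Matrix.sum_apply, Matrix.smul_apply, smul_eq_mul]
  rw [Finset.prod_univ_sum, Fintype.piFinset_univ]
  refine Finset.sum_congr rfl fun y _ => ?_
  rw [Finset.prod_mul_distrib]
  simp [blockWeight, prodDist]

theorem sum_expect_piecewise (S : Finset Part) (z : Fin n → ∀ l, 𝒳 l)
    (A : Matrix (Fin n → B) (Fin n → B) ℂ) :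
    ∑ y, blockWeight p y * expect (tensor fun i => ρ (S.piecewise (z i) (y i))) A =
      expect (tensor fun i => averagedState p ρ S (z i)) A := by
  rw [tensor_averagedState, expect_linear_state]

/-- Observables that depend only on the parts in `S` see the state averaged over the others. -/
theorem sum_expect_eq_averaged (h1 : ∀ l, ∑ a, p l a = 1) (S : Finset Part)
    (A : (Fin n → ∀ l, 𝒳 l) → Matrix (Fin n → B) (Fin n → B) ℂ)
    (hA : ∀ z z' : Fin n → ∀ l, 𝒳 l, (∀ i, ∀ l ∈ S, z i l = z' i l) → A z = A z') :
    ∑ z, blockWeight p z * expect (tensor fun i => ρ (z i)) (A z) =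
      ∑ z, blockWeight p z * expect (tensor fun i => averagedState p ρ S (z i)) (A z) := by
  rw [sum_blockWeight_resample h1 S]
  refine Finset.sum_congr rfl fun z _ => ?_
  rw [← sum_expect_piecewise]
  congr 1
  refine Finset.sum_congr rfl fun y _ => ?_
  rw [hA (fun i => S.piecewise (z i) (y i)) z fun i l hl => by simp [hl]]

theorem condEntropy_mul_log_two (h : ∀ S x, (averagedState p ρ S x).IsHermitian) (S : Finset Part) :
    condEntropy p ρ S * Real.log 2 =
      ∑ x, prodDist p x * ∑ b, Real.negMulLog ((h S x).eigenvalues b) := by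
  have h2 : Real.log 2 ≠ 0 := (Real.log_pos one_lt_two).ne'
  rw [condEntropy, Finset.sum_mul]
  refine Finset.sum_congr rfl fun x _ => ?_
  rw [vonNeumannEntropy, dif_pos (h S x), mul_assoc, div_mul_cancel₀ _ h2]

end Averaged

/-! ### Tests for one decoding stage -/

section Stage

variable {𝒳 : Part → Type*} [∀ l, Fintype (𝒳 l)] {B : Type*} [Fintype B] [DecidableEq B]
  {p : ∀ l, 𝒳 l → ℝ} {ρ : (∀ l, 𝒳 l) → Matrix B B ℂ}

/-- A sequence of tests that depend on the parts in `S`, accept the averaged state given the parts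
in `S` with high probability, and the averaged state given the parts in `T` with probability
at most `2 ^ (-n I)`. -/
structure StageTests (p : ∀ l, 𝒳 l → ℝ) (ρ : (∀ l, 𝒳 l) → Matrix B B ℂ) (T S : Finset Part)
    (I : ℝ) where
  /-- The test on `n` systems given the codewords `z`. -/
  test : ∀ n, (Fin n → ∀ l, 𝒳 l) → Matrix (Fin n → B) (Fin n → B) ℂ
  effect : ∀ n z, 0 ≤ test n z ∧ test n z ≤ 1
  congr : ∀ n (z z' : Fin n → ∀ l, 𝒳 l), (∀ i, ∀ l ∈ S, z i l = z' i l) → test n z = test n z'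
  tendsto : Tendsto (fun n => ∑ z : Fin n → ∀ l, 𝒳 l, blockWeight p z *
    expect (tensor fun i => ρ (z i)) (1 - test n z)) atTop (𝓝 0)
  bound : ∀ n z, expect (tensor fun i => averagedState p ρ T (z i)) (test n z) ≤
    2 ^ (-(n * I))

theorem exists_stageTests (hp : ∀ l, p l ∈ stdSimplex ℝ (𝒳 l)) (hρ : ∀ x, (ρ x).PosSemidef)
    (hρt : ∀ x, (ρ x).trace = 1) {T S : Finset Part} (hTS : T ⊆ S) {δ : ℝ} (hδ : 0 < δ) :
    Nonempty (StageTests p ρ T S (condEntropy p ρ T - condEntropy p ρ S - δ)) := by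
  have hp0 : ∀ l a, 0 ≤ p l a := fun l a => (hp l).1 a
  have hp1 : ∀ l, ∑ a, p l a = 1 := fun l => (hp l).2
  have hP := averagedState_posSemidef hp0 hρ
  have hH : ∀ S x, (averagedState p ρ S x).IsHermitian := fun S x => (hP S x).isHermitian
  have hT := averagedState_trace hp1 hρt
  have hl0 : ∀ S x b, 0 ≤ (hH S x).eigenvalues b := fun S x b => (hP S x).eigenvalues_nonneg b
  have hl1 : ∀ S x, ∑ b, (hH S x).eigenvalues b = 1 := fun S x =>
    sum_eigenvalues_eq_one (hH S x) (hT S x)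
  -- Each of the two projections uses up half of the slack `δ`; the factor `Real.log 2` converts
  -- bits to nats.
  have hε : 0 < δ / 2 * Real.log 2 := mul_pos (half_pos hδ) (Real.log_pos one_lt_two)
  obtain ⟨c, c0, c1, hc⟩ := exists_upper_equipartition (P := prodDist p)
    (lam := fun x => (hH T x).eigenvalues) (prodDist_nonneg hp0) (sum_prod_eq_one hp1)
    (hl0 T) (hl1 T) hε
  obtain ⟨d, d0, d1, hd⟩ := exists_lower_equipartition (P := prodDist p)
    (lam := fun x => (hH S x).eigenvalues) (prodDist_nonneg hp0) (sum_prod_eq_one hp1)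
    (hl0 S) (hl1 S) hε
  rw [← condEntropy_mul_log_two hH] at hc hd
  let τ : ℕ → ℝ := fun n =>
    Real.exp (-(n * (condEntropy p ρ T * Real.log 2 - δ / 2 * Real.log 2)))
  let τ' : ℕ → ℝ := fun n =>
    Real.exp (-(n * (condEntropy p ρ S * Real.log 2 + δ / 2 * Real.log 2)))
  have hcongr : ∀ (S' : Finset Part), S' ⊆ S → ∀ n (z z' : Fin n → ∀ l, 𝒳 l),
      (∀ i, ∀ l ∈ S, z i l = z' i l) →
      (fun i => averagedState p ρ S' (z i)) = fun i => averagedState p ρ S' (z' i) :=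
    fun S' hS' n z z' h => funext fun i => averagedState_congr fun l hl => h i l (hS' hl)
  let t : ∀ n, (Fin n → ∀ l, 𝒳 l) → Matrix (Fin n → B) (Fin n → B) ℂ := fun n z =>
    typicalTest (fun i => hH T (z i)) (fun i => hH S (z i)) (τ n) (τ' n)
  have heff : ∀ n z, 0 ≤ t n z ∧ t n z ≤ 1 := fun n z => typicalTest_effect _ _ _ _
  have hten : ∀ n (z : Fin n → ∀ l, 𝒳 l), (tensor fun i => ρ (z i)).PosSemidef := fun n z =>
    tensor_posSemidef fun i => hρ _
  refine ⟨⟨t, heff, fun n z z' h => ?_, ?_, fun n z => ?_⟩⟩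
  · exact typicalTest_congr _ _ _ _ _ _ (hcongr T hTS n z z' h) (hcongr S subset_rfl n z z' h)
  · have hle : ∀ n, ∑ z : Fin n → ∀ l, 𝒳 l, blockWeight p z *
        expect (tensor fun i => ρ (z i)) (1 - t n z) ≤ 4 * (c ^ n + d ^ n) := fun n => by
      have h1 : ∑ z : Fin n → ∀ l, 𝒳 l, blockWeight p z *
          expect (tensor fun i => ρ (z i)) (1 - upperProj (fun i => hH T (z i)) (τ n)) ≤ c ^ n := by
        -- The projection depends only on the parts in `T`, so it meets the very state whose
        -- spectrum defines it, and its expectation is a tail sum of eigenvalues.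
        rw [sum_expect_eq_averaged hp1 T fun z => 1 - upperProj (fun i => hH T (z i)) (τ n)]
        · simp only [expect_one_sub_upperProj]
          exact hc n
        · intro z z' h
          exact congrArg (1 - ·) (upperProj_congr _ _ _
            (funext fun i => averagedState_congr (h i)))
      have h2 : ∑ z : Fin n → ∀ l, 𝒳 l, blockWeight p z *
          expect (tensor fun i => ρ (z i)) (1 - lowerProj (fun i => hH S (z i)) (τ' n)) ≤ d ^ n := by
        rw [sum_expect_eq_averaged hp1 S fun z => 1 - lowerProj (fun i => hH S (z i)) (τ' n)]
        · simp only [expect_one_sub_lowerProj]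
          exact hd n
        · intro z z' h
          exact congrArg (1 - ·) (lowerProj_congr _ _ _
            (funext fun i => averagedState_congr (h i)))
      refine le_trans ?_ (mul_le_mul_of_nonneg_left (add_le_add h1 h2) (by norm_num))
      rw [← Finset.sum_add_distrib, Finset.mul_sum]
      refine Finset.sum_le_sum fun z _ => ?_
      have := expect_mono (hten n z) (one_sub_typicalTest_le (fun i => hH T (z i))
        (fun i => hH S (z i)) (τ n) (τ' n))
      rw [expect_four_mul, expect_add] at this
      refine (mul_le_mul_of_nonneg_left this (blockWeight_nonneg hp0 z)).trans (le_of_eq ?_)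
      ring
    refine squeeze_zero (fun n => Finset.sum_nonneg fun z _ => mul_nonneg
      (blockWeight_nonneg hp0 z) (expect_nonneg (hten n z) (sub_nonneg.2 (heff n z).2))) hle ?_
    have := ((tendsto_pow_atTop_nhds_zero_of_lt_one c0 c1).add
      (tendsto_pow_atTop_nhds_zero_of_lt_one d0 d1)).const_mul (4 : ℝ)
    simpa using this
  · refine (expect_typicalTest_le (fun i => hH T (z i)) (fun i => hH S (z i)) (τ n) (τ' n)
      (fun i => hP S _) (fun i => hT S _) (Real.exp_pos _).le (Real.exp_pos _)).trans
      (le_of_eq ?_)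
    rw [← Real.exp_sub, Real.rpow_def_of_pos two_pos]
    congr 1
    ring

variable {L : Part → ℕ} {n : ℕ}

/-- The random coding bound for a wrong message at one decoding stage. -/
theorem sum_codebookWeight_wrong_le (hp : ∀ l, p l ∈ stdSimplex ℝ (𝒳 l)) {T : Finset Part}
    {l : Part} (hl : l ∉ T) {I : ℝ} (t : StageTests p ρ T (insert l T) I) (m : ∀ l, Fin (L l))
    {k : Fin (L l)} (hk : k ≠ m l) :
    ∑ c : Codebook 𝒳 L n, codebookWeight p c *
      expect (tensor fun i => ρ (codewords c m i))
        (t.test n (codewords c (Function.update m l k))) ≤ 2 ^ (-(n * I)) := by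
  have hp0 : ∀ l a, 0 ≤ p l a := fun l a => (hp l).1 a
  have hp1 : ∀ l, ∑ a, p l a = 1 := fun l => (hp l).2
  -- Only the transmitted codewords of the parts outside `T` are resampled. The test for `k ≠ m l`
  -- does not involve them, while the state averages to the one given `T`.
  let A : Finset (Σ l, Fin (L l)) := {q | ¬ (q.1 ∉ T ∧ q.2 = m q.1)}
  have hmem : ∀ s, (⟨s, m s⟩ : Σ l, Fin (L l)) ∈ A ↔ s ∈ T := fun s => by simp [A]
  have h1 := sum_blockWeight_resample (n := n) (w := fun q : (Σ l, Fin (L l)) => p q.1)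
    (fun q => hp1 q.1) A fun c => expect (tensor fun i => ρ (codewords c m i))
        (t.test n (codewords c (Function.update m l k)))
  simp only [codebookWeight]
  rw [h1]
  have h2 : ∀ c : Codebook 𝒳 L n, ∑ c' : Codebook 𝒳 L n,
      blockWeight (fun q : (Σ l, Fin (L l)) => p q.1) c' *
        expect (tensor fun i => ρ (codewords (fun i => A.piecewise (c i) (c' i)) m i))
        (t.test n (codewords (fun i => A.piecewise (c i) (c' i)) (Function.update m l k)))
      ≤ 2 ^ (-(n * I)) := fun c => by
    have e1 : ∀ c' : Codebook 𝒳 L n, ∀ i, codewords (fun i => A.piecewise (c i) (c' i)) m i =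
        T.piecewise (codewords c m i) (codewords c' m i) := fun c' i => by
      funext s
      by_cases hs : s ∈ T
      · simp [codewords, hs, (hmem s).2 hs]
      · simp [codewords, hs, mt (hmem s).1 hs]
    have e2 : ∀ c' : Codebook 𝒳 L n,
        t.test n (codewords (fun i => A.piecewise (c i) (c' i)) (Function.update m l k)) =
        t.test n (codewords c (Function.update m l k)) := fun c' => by
      refine t.congr n _ _ fun i s hs => ?_
      rcases Finset.mem_insert.1 hs with rfl | hs
      · have : (⟨s, k⟩ : Σ l, Fin (L l)) ∈ A := by simp [A, hk]
        simp [codewords, this]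
      · have : s ≠ l := fun h => hl (h ▸ hs)
        simp [codewords, this, (hmem s).2 hs]
    simp only [e1, e2]
    have h3 := sum_codebookWeight_comp hp1 m fun y => expect (tensor fun i => ρ
      (T.piecewise (codewords c m i) (y i))) (t.test n (codewords c (Function.update m l k)))
    simp only [codebookWeight] at h3
    rw [h3, sum_expect_piecewise]
    refine le_of_eq_of_le ?_ (t.bound n (codewords c (Function.update m l k)))
    congr 2
    funext i
    refine averagedState_congr fun s hs => ?_
    have : s ≠ l := fun h => hl (h ▸ hs)
    rw [codewords, codewords, Function.update_of_ne this]
  refine (Finset.sum_le_sum fun c _ => mul_le_mul_of_nonneg_left (h2 c)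
    (blockWeight_nonneg (fun q => hp0 q.1) c)).trans (le_of_eq ?_)
  rw [← Finset.sum_mul, sum_blockWeight fun q : (Σ l, Fin (L l)) => hp1 q.1, one_mul]

/-- The error operator of one decoding stage. -/
def stageError {T : Finset Part} {l : Part} {I : ℝ} (t : StageTests p ρ T (insert l T) I)
    (c : Codebook 𝒳 L n) (m : ∀ l, Fin (L l)) : Matrix (Fin n → B) (Fin n → B) ℂ :=
  (∑ k with k < m l, t.test n (codewords c (Function.update m l k)))
    + (1 - t.test n (codewords c m))

/-- Only candidates preceding `m l` can be accepted wrongly before it, hence at most `L l - 1` of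
them. -/
theorem sum_expect_stageError_le (hp : ∀ l, p l ∈ stdSimplex ℝ (𝒳 l)) {T : Finset Part}
    {l : Part} (hl : l ∉ T) {I : ℝ} (t : StageTests p ρ T (insert l T) I) (m : ∀ l, Fin (L l)) :
    ∑ c : Codebook 𝒳 L n, codebookWeight p c *
      expect (tensor fun i => ρ (codewords c m i)) (stageError t c m) ≤
    ((L l : ℝ) - 1) * 2 ^ (-(n * I)) + ∑ z : Fin n → ∀ l, 𝒳 l, blockWeight p z *
      expect (tensor fun i => ρ (z i)) (1 - t.test n z) := by
  have hp1 : ∀ l, ∑ a, p l a = 1 := fun l => (hp l).2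
  simp only [stageError, expect_add, expect_sum, mul_add, Finset.mul_sum, Finset.sum_add_distrib]
  rw [Finset.sum_comm]
  refine add_le_add ?_ (le_of_eq (sum_codebookWeight_comp hp1 m fun z =>
    expect (tensor fun i => ρ (z i)) (1 - t.test n z)))
  refine (Finset.sum_le_card_nsmul _ _ _ fun k hk =>
    sum_codebookWeight_wrong_le hp hl t m (Finset.mem_filter.1 hk).2.ne).trans ?_
  rw [nsmul_eq_mul]
  refine mul_le_mul_of_nonneg_right ?_ (Real.rpow_nonneg two_pos.le _)
  have h1 : (Finset.univ.filter (· < m l)).card + 1 ≤ L l := by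
    have : Finset.univ.filter (· < m l) = Finset.Iio (m l) := by ext; simp
    rw [this, Fin.card_Iio]
    exact (m l).2
  have : ((Finset.univ.filter (· < m l)).card : ℝ) + 1 ≤ L l := by exact_mod_cast h1
  linarith

end Stage

/-! ### Decoding at one receiver -/

section Receiver

/-- Outcomes are merged along `φ`, and the missing weight `1 - ∑ k, E k` goes to an arbitrary
outcome. -/
theorem exists_povm_ge {ι M K : Type*} [Fintype ι] [Fintype M] [Nonempty M] [Fintype K]
    [DecidableEq K] (E : ι → Matrix K K ℂ) (h0 : ∀ k, 0 ≤ E k) (h1 : ∑ k, E k ≤ 1) (φ : ι → M) :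
    ∃ Λ : POVM M K, ∀ k, E k ≤ Λ.op (φ k) := by
  classical
  obtain ⟨m₀⟩ := ‹Nonempty M›
  have hr : ∀ m : M, 0 ≤ if m = m₀ then 1 - ∑ k, E k else 0 := fun m => by
    split_ifs
    · exact sub_nonneg.2 h1
    · exact le_rfl
  refine ⟨⟨fun m => (∑ k with φ k = m, E k) + if m = m₀ then 1 - ∑ k, E k else 0, fun m => ?_, ?_⟩,
    fun k => ?_⟩
  · exact nonneg_iff_posSemidef.1 (add_nonneg (Finset.sum_nonneg fun k _ => h0 k) (hr m))
  · have h2 : ∑ m, ∑ k with φ k = m, E k = ∑ k, E k := Finset.sum_fiberwise Finset.univ φ E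
    rw [Finset.sum_add_distrib, h2]
    simp
  · exact le_add_of_le_of_nonneg (Finset.single_le_sum (f := E) (fun k _ => h0 k)
      (Finset.mem_filter.2 ⟨Finset.mem_univ k, rfl⟩)) (hr _)

theorem one_le_numMessages (n : ℕ) (R : ℝ) : 1 ≤ numMessages n R :=
  Nat.one_le_ceil_iff.2 (Real.rpow_pos_of_pos two_pos _)

/-- The `- 1` undoes the rounding up. It is essential for `I < 0`, where a single message already
has a growing factor `2 ^ (-(n * I))`. -/
theorem tendsto_numMessages_mul {R I : ℝ} (h : R < I) :
    Tendsto (fun n : ℕ => ((numMessages n R : ℝ) - 1) * 2 ^ (-((n : ℝ) * I))) atTop (𝓝 0) := by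
  have hlt : (2 : ℝ) ^ (R - I) < 1 := Real.rpow_lt_one_of_one_lt_of_neg one_lt_two (by linarith)
  refine squeeze_zero (fun n => mul_nonneg ?_ (Real.rpow_nonneg two_pos.le _)) (fun n => ?_)
    (tendsto_pow_atTop_nhds_zero_of_lt_one (Real.rpow_nonneg two_pos.le _) hlt)
  · have : (1 : ℝ) ≤ numMessages n R := by exact_mod_cast one_le_numMessages n R
    linarith
  · have h1 : (numMessages n R : ℝ) - 1 ≤ 2 ^ ((n : ℝ) * R) := by
      have := Nat.ceil_lt_add_one (Real.rpow_nonneg (two_pos (α := ℝ)).le ((n : ℝ) * R))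
      rw [numMessages]
      linarith
    refine (mul_le_mul_of_nonneg_right h1 (Real.rpow_nonneg two_pos.le _)).trans (le_of_eq ?_)
    rw [← Real.rpow_add two_pos, ← Real.rpow_natCast, ← Real.rpow_mul two_pos.le]
    congr 1
    ring

variable {𝒳 : Part → Type*} [∀ l, Fintype (𝒳 l)] {B : Type*} [Fintype B] [DecidableEq B]
  {p : ∀ l, 𝒳 l → ℝ} {ρ : (∀ l, 𝒳 l) → Matrix B B ℂ}

theorem stageError_eq {L : Part → ℕ} {n : ℕ} {T : Finset Part} {l : Part} {I : ℝ}
    (t : StageTests p ρ T (insert l T) I) (c : Codebook 𝒳 L n) (m : ∀ l, Fin (L l))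
    (u : Fin (L l) → ∀ l, Fin (L l)) (hu : ∀ j, ∀ s ∈ insert l T, u j s = Function.update m l j s) :
    (∑ j with j < m l, t.test n (codewords c (u j))) + (1 - t.test n (codewords c (u (m l)))) =
      stageError t c m := by
  have h : ∀ j, t.test n (codewords c (u j)) = t.test n (codewords c (Function.update m l j)) :=
    fun j => t.congr n _ _ fun i s hs => by rw [codewords, codewords, hu j s hs]
  simp only [h, stageError, Function.update_eq_self]

/-- The tests lose `δ / 2` and the rates are lowered by `δ`, so the number of wrong candidates is
beaten at each stage. The bound holds for every message tuple, so `φ` may select any function of the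
decoded parts. -/
theorem exists_decoder (hp : ∀ l, p l ∈ stdSimplex ℝ (𝒳 l)) (hρ : ∀ x, (ρ x).PosSemidef)
    (hρt : ∀ x, (ρ x).trace = 1) {D : Finset Part} (π : Fin 3 ≃ D) {R : Part → ℝ}
    (hR : SuccessiveRates p ρ π R) {δ : ℝ} (hδ : 0 < δ) :
    ∃ η : ℕ → ℝ, Tendsto η atTop (𝓝 0) ∧ ∀ (n : ℕ) (M : Type) [Fintype M] [Nonempty M]
      (φ : (∀ l, Fin (numMessages n (R l - δ))) → M)
      (_ : ∀ m m', (∀ l ∈ D, m l = m' l) → φ m = φ m'),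
      ∃ Λ : Codebook 𝒳 (fun l => numMessages n (R l - δ)) n → POVM M (Fin n → B),
        ∀ m, ∑ c, codebookWeight p c *
          expect (tensor fun i => ρ (codewords c m i)) (1 - (Λ c).op (φ m)) ≤ η n := by
  have hp0 : ∀ l a, 0 ≤ p l a := fun l a => (hp l).1 a
  have hδ2 : 0 < δ / 2 := half_pos hδ
  obtain ⟨hR0, hR1, hR2⟩ := hR
  have hne : ∀ i j : Fin 3, i ≠ j → (π i : Part) ≠ π j := fun i j h e =>
    h (π.injective (Subtype.ext e))
  have h10 := hne 1 0 (by decide)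
  have h20 := hne 2 0 (by decide)
  have h21 := hne 2 1 (by decide)
  have hD : ∀ l ∈ D, l = π 0 ∨ l = π 1 ∨ l = π 2 := fun l hl => by
    obtain ⟨i, hi⟩ := π.surjective ⟨l, hl⟩
    have : l = π i := by rw [hi]
    fin_cases i
    · exact Or.inl this
    · exact Or.inr (Or.inl this)
    · exact Or.inr (Or.inr this)
  generalize (π 0 : Part) = l₀ at *
  generalize (π 1 : Part) = l₁ at *
  generalize (π 2 : Part) = l₂ at *
  obtain ⟨t₀⟩ := exists_stageTests hp hρ hρt (Finset.subset_insert l₀ ∅) hδ2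
  obtain ⟨t₁⟩ := exists_stageTests hp hρ hρt (Finset.subset_insert l₁ {l₀}) hδ2
  obtain ⟨t₂⟩ := exists_stageTests hp hρ hρt (Finset.subset_insert l₂ {l₀, l₁}) hδ2
  rw [condMutualInfo] at hR0 hR1 hR2
  have l0 : l₀ ∉ (∅ : Finset Part) := by simp
  have l1 : l₁ ∉ ({l₀} : Finset Part) := by simpa using h10
  have l2 : l₂ ∉ ({l₀, l₁} : Finset Part) := by simpa using ⟨h20, h21⟩
  have e0 := (tendsto_numMessages_mul (R := R l₀ - δ)
    (I := condEntropy p ρ ∅ - condEntropy p ρ (insert l₀ ∅) - δ / 2) (by linarith)).add t₀.tendsto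
  have e1 := (tendsto_numMessages_mul (R := R l₁ - δ)
    (I := condEntropy p ρ {l₀} - condEntropy p ρ {l₁, l₀} - δ / 2) (by linarith)).add t₁.tendsto
  have e2 := (tendsto_numMessages_mul (R := R l₂ - δ)
    (I := condEntropy p ρ {l₀, l₁} - condEntropy p ρ {l₂, l₀, l₁} - δ / 2)
    (by linarith)).add t₂.tendsto
  have hη := (e0.add (e1.add e2)).const_mul (4 : ℝ)
  simp only [add_zero, mul_zero] at hη
  refine ⟨_, hη, fun n M _ _ φ hφ => ?_⟩
  -- A filler for the parts not yet decoded or never decoded, which the tests and `φ` ignore.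
  let m₀ : ∀ l, Fin (numMessages n (R l - δ)) := fun l => ⟨0, one_le_numMessages _ _⟩
  let u₀ := fun a => Function.update m₀ l₀ a
  let u₁ := fun a b => Function.update (u₀ a) l₁ b
  let u₂ := fun a b d => Function.update (u₁ a b) l₂ d
  have key : ∀ c : Codebook 𝒳 (fun l => numMessages n (R l - δ)) n, ∃ Λ : POVM M (Fin n → B),
      ∀ m, 1 - Λ.op (φ m) ≤ 4 * (stageError t₀ c m + (stageError t₁ c m + stageError t₂ c m)) := by
    intro c
    obtain ⟨E, hE0, hE1, hE⟩ := exists_successive_family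
      (fun a => t₀.test n (codewords c (u₀ a))) (fun a b => t₁.test n (codewords c (u₁ a b)))
      (fun a b d => t₂.test n (codewords c (u₂ a b d))) (fun _ => t₀.effect _ _)
      (fun _ _ => t₁.effect _ _) (fun _ _ _ => t₂.effect _ _)
    obtain ⟨Λ, hΛ⟩ := exists_povm_ge E hE0 hE1 fun k => φ (u₂ k.1 k.2.1 k.2.2)
    refine ⟨Λ, fun m => ?_⟩
    have h1 : φ m = φ (u₂ (m l₀) (m l₁) (m l₂)) := hφ _ _ fun l hl => by
      rcases hD l hl with rfl | rfl | rfl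
      · simp [u₂, u₁, u₀, h20.symm, h10.symm]
      · simp [u₂, u₁, h21.symm]
      · simp [u₂]
    rw [h1]
    refine (sub_le_sub_left (hΛ (m l₀, m l₁, m l₂)) 1).trans
      ((hE (m l₀) (m l₁) (m l₂)).trans (le_of_eq ?_))
    have s0 := stageError_eq t₀ c m u₀ fun j s hs => by
      have : s = l₀ := by simpa using hs
      subst this
      simp [u₀]
    have s1 := stageError_eq t₁ c m (u₁ (m l₀)) fun j s hs => by
      have : s = l₁ ∨ s = l₀ := by simpa using hs
      rcases this with rfl | rfl
      · simp [u₁]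
      · simp [u₁, u₀, h10.symm]
    have s2 := stageError_eq t₂ c m (u₂ (m l₀) (m l₁)) fun j s hs => by
      have : s = l₂ ∨ s = l₀ ∨ s = l₁ := by simpa using hs
      rcases this with rfl | rfl | rfl
      · simp [u₂]
      · simp [u₂, u₁, u₀, h10.symm, h20.symm]
      · simp [u₂, u₁, h21.symm]
    rw [s0, s1, s2]
  choose Λ hΛ using key
  refine ⟨Λ, fun m => ?_⟩
  have e := add_le_add (sum_expect_stageError_le (n := n) hp l0 t₀ m)
    (add_le_add (sum_expect_stageError_le (n := n) hp l1 t₁ m)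
      (sum_expect_stageError_le (n := n) hp l2 t₂ m))
  refine le_trans ?_ (mul_le_mul_of_nonneg_left e (by norm_num : (0 : ℝ) ≤ 4))
  rw [← Finset.sum_add_distrib, ← Finset.sum_add_distrib, Finset.mul_sum]
  refine Finset.sum_le_sum fun c _ => ?_
  have := expect_mono (tensor_posSemidef fun i => hρ (codewords c m i)) (hΛ c m)
  rw [expect_four_mul, expect_add, expect_add] at this
  refine (mul_le_mul_of_nonneg_left this (blockWeight_nonneg (fun q => hp0 q.1) c)).trans
    (le_of_eq ?_)
  rw [codebookWeight]
  ring

end Receiver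

/-! ### Two receivers -/

section Bipartite

variable {K₁ K₂ : Type*} [Fintype K₁] [Fintype K₂] [DecidableEq K₁] [DecidableEq K₂]

theorem expect_kronecker_one (ρ : Matrix (K₁ × K₂) (K₁ × K₂) ℂ) (A : Matrix K₁ K₁ ℂ) :
    expect ρ (A ⊗ₖ 1) = expect (traceSecond ρ) A := by
  rw [expect, expect]
  congr 1
  simp only [trace, diag_apply, mul_apply, Fintype.sum_prod_type, kroneckerMap_apply, traceSecond,
    of_apply, Finset.mul_sum, one_apply, mul_ite, mul_one, mul_zero, ite_mul, zero_mul,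
    Finset.sum_ite_eq, Finset.mem_univ, if_true]
  exact Finset.sum_congr rfl fun b _ => Finset.sum_comm

theorem expect_one_kronecker (ρ : Matrix (K₁ × K₂) (K₁ × K₂) ℂ) (A : Matrix K₂ K₂ ℂ) :
    expect ρ (1 ⊗ₖ A) = expect (traceFirst ρ) A := by
  rw [expect, expect]
  congr 1
  simp only [trace, diag_apply, mul_apply, Fintype.sum_prod_type_right, kroneckerMap_apply,
    traceFirst, of_apply, Finset.mul_sum, one_apply, ite_mul, one_mul, zero_mul,
    Finset.sum_ite_eq, Finset.mem_univ, if_true]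
  exact Finset.sum_congr rfl fun b _ => Finset.sum_comm

/-- A union bound for commuting effects: the two sides differ by the expectation of `(1 - A) ⊗ₖ (1 -
A')`. -/
theorem expect_one_sub_kronecker_le {ρ : Matrix (K₁ × K₂) (K₁ × K₂) ℂ} (hρ : ρ.PosSemidef)
    {A : Matrix K₁ K₁ ℂ} {A' : Matrix K₂ K₂ ℂ} (hA : A ≤ 1) (hA' : A' ≤ 1) :
    expect ρ (1 - A ⊗ₖ A') ≤ expect (traceSecond ρ) (1 - A) + expect (traceFirst ρ) (1 - A') := by
  rw [← expect_kronecker_one, ← expect_one_kronecker, ← expect_add]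
  refine expect_mono hρ ?_
  have h := ((nonneg_iff_posSemidef.1 (sub_nonneg.2 hA)).kronecker
    (nonneg_iff_posSemidef.1 (sub_nonneg.2 hA'))).nonneg
  rw [← sub_nonneg]
  convert h using 1
  ext ⟨b, c⟩ ⟨b', c'⟩
  by_cases hb : b = b' <;> by_cases hc : c = c' <;> simp [hb, hc] <;> ring

theorem traceSecond_posSemidef {ρ : Matrix (K₁ × K₂) (K₁ × K₂) ℂ} (hρ : ρ.PosSemidef) :
    (traceSecond ρ).PosSemidef := by
  have : traceSecond ρ = ∑ c, ρ.submatrix (fun b => (b, c)) fun b => (b, c) := by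
    ext b b'
    simp [traceSecond, Matrix.sum_apply]
  rw [this]
  exact posSemidef_sum _ fun c _ => hρ.submatrix _

theorem traceFirst_posSemidef {ρ : Matrix (K₁ × K₂) (K₁ × K₂) ℂ} (hρ : ρ.PosSemidef) :
    (traceFirst ρ).PosSemidef := by
  have : traceFirst ρ = ∑ b, ρ.submatrix (fun c => (b, c)) fun c => (b, c) := by
    ext b b'
    simp [traceFirst, Matrix.sum_apply]
  rw [this]
  exact posSemidef_sum _ fun c _ => hρ.submatrix _

theorem trace_traceSecond (ρ : Matrix (K₁ × K₂) (K₁ × K₂) ℂ) : (traceSecond ρ).trace = ρ.trace := by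
  simp [trace, traceSecond, Fintype.sum_prod_type]

theorem trace_traceFirst (ρ : Matrix (K₁ × K₂) (K₁ × K₂) ℂ) : (traceFirst ρ).trace = ρ.trace := by
  simp [trace, traceFirst, Fintype.sum_prod_type_right]

theorem POVM.op_le_one {M : Type*} [Fintype M] (Λ : POVM M K₁) (m : M) : Λ.op m ≤ 1 := by
  rw [← Λ.sum_op]
  exact Finset.single_le_sum (f := Λ.op) (fun m _ => (Λ.op_posSemidef m).nonneg) (Finset.mem_univ m)

end Bipartite

/-! ### Marginals of the block states. -/

section Block

variable {X₁ X₂ B₁ B₂ : Type*} [Fintype B₁] [Fintype B₂] [DecidableEq B₁] [DecidableEq B₂]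
  (N : CQInterferenceChannel X₁ X₂ B₁ B₂) {n : ℕ} (x₁ : Fin n → X₁) (x₂ : Fin n → X₂)

theorem blockState_posSemidef : (N.blockState x₁ x₂).PosSemidef :=
  (tensor_posSemidef fun i => N.state_posSemidef (x₁ i) (x₂ i)).submatrix
    fun b : (Fin n → B₁) × (Fin n → B₂) => fun i => (b.1 i, b.2 i)

theorem traceSecond_blockState :
    traceSecond (N.blockState x₁ x₂) = tensor fun i => traceSecond (N.state (x₁ i) (x₂ i)) := by
  ext b b'
  simp only [traceSecond, CQInterferenceChannel.blockState, tensor, of_apply]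
  rw [Finset.prod_univ_sum, Fintype.piFinset_univ]

theorem traceFirst_blockState :
    traceFirst (N.blockState x₁ x₂) = tensor fun i => traceFirst (N.state (x₁ i) (x₂ i)) := by
  ext b b'
  simp only [traceFirst, CQInterferenceChannel.blockState, tensor, of_apply]
  rw [Finset.prod_univ_sum, Fintype.piFinset_univ]

end Block

/-! ### Derandomization and assembly of the code -/

theorem exists_le_of_sum_weight_mul_le {ι : Type*} [Fintype ι] {w f : ι → ℝ} {ε : ℝ}
    (h0 : ∀ i, 0 ≤ w i) (h1 : ∑ i, w i = 1) (h : ∑ i, w i * f i ≤ ε) : ∃ i, f i ≤ ε := by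
  by_contra! hf
  have h2 : ∑ i, w i * (f i - ε) ≤ 0 := by
    simp only [mul_sub, Finset.sum_sub_distrib, ← Finset.sum_mul, h1]
    linarith
  have h3 : ∀ i ∈ Finset.univ, 0 ≤ w i * (f i - ε) := fun i _ =>
    mul_nonneg (h0 i) (sub_nonneg.2 (hf i).le)
  have h4 := (Finset.sum_eq_zero_iff_of_nonneg h3).1 (le_antisymm h2 (Finset.sum_nonneg h3))
  have h5 : ∀ i, w i = 0 := fun i =>
    (mul_eq_zero.1 (h4 i (Finset.mem_univ i))).resolve_right (sub_pos.2 (hf i)).ne'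
  simp [h5] at h1

theorem numMessages_add_le (n : ℕ) (a b : ℝ) :
    numMessages n (a + b) ≤ numMessages n a * numMessages n b := by
  rw [numMessages, Nat.ceil_le, mul_add, Real.rpow_add two_pos]
  push_cast
  exact mul_le_mul (Nat.le_ceil _) (Nat.le_ceil _) (Real.rpow_nonneg two_pos.le _)
    (Nat.cast_nonneg _)

/-- Rounding up makes the product of the part sizes possibly larger than the message set, so an
injection replaces a bijection. -/
theorem exists_injective_split (n : ℕ) {a b c : ℝ} (h : c = a + b) :
    ∃ s : Fin (numMessages n c) → Fin (numMessages n a) × Fin (numMessages n b),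
      Function.Injective s := by
  subst h
  exact ⟨fun k => finProdFinEquiv.symm (Fin.castLE (numMessages_add_le n a b) k),
    finProdFinEquiv.symm.injective.comp (Fin.castLE_injective _)⟩

theorem SuccessiveRates.mono {𝒳 : Part → Type*} [∀ l, Fintype (𝒳 l)] {B : Type*} [Fintype B]
    [DecidableEq B] {p : ∀ l, 𝒳 l → ℝ} {ρ : (∀ l, 𝒳 l) → Matrix B B ℂ} {D : Finset Part}
    {π : Fin 3 ≃ D} {R R' : Part → ℝ} (h : SuccessiveRates p ρ π R) (hR : ∀ l ∈ D, R' l ≤ R l) :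
    SuccessiveRates p ρ π R' :=
  ⟨(hR _ (π 0).2).trans h.first, (hR _ (π 1).2).trans h.second, (hR _ (π 2).2).trans h.third⟩

/-- A family indexed by the parts. -/
def partFamily {α : Part → Type*} (a : α Part.p1) (b : α Part.c1) (c : α Part.c2)
    (d : α Part.p2) : ∀ l, α l
  | Part.p1 => a
  | Part.c1 => b
  | Part.c2 => c
  | Part.p2 => d

end RateSplitIC

end

/-! ### The interference channel code. -/

open RateSplitIC in
theorem mainTheorem6 {X₁ X₂ B₁ B₂ : Type*} [Finite X₁] [Finite X₂]
    [Fintype B₁] [Fintype B₂] [DecidableEq B₁] [DecidableEq B₂]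
    (N : CQInterferenceChannel X₁ X₂ B₁ B₂)
    {𝒳 : Part → Type*} [∀ l, Fintype (𝒳 l)]
    (p : ∀ l, 𝒳 l → ℝ) (hp : ∀ l, p l ∈ stdSimplex ℝ (𝒳 l))
    (f₁ : 𝒳 Part.p1 → 𝒳 Part.c1 → X₁) (f₂ : 𝒳 Part.p2 → 𝒳 Part.c2 → X₂)
    (π₁ : Fin 3 ≃ decoded₁) (π₂ : Fin 3 ≃ decoded₂)
    (R₁ R₂ : Part → ℝ)
    (hR₁ : SuccessiveRates p (splitState₁ N f₁ f₂) π₁ R₁)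
    (hR₂ : SuccessiveRates p (splitState₂ N f₁ f₂) π₂ R₂) :
    Achievable N
      (R₁ Part.p1 + min (R₁ Part.c1) (R₂ Part.c1))
      (min (R₁ Part.c2) (R₂ Part.c2) + R₂ Part.p2) := by
  intro ε hε δ hδ
  have hp0 : ∀ l a, 0 ≤ p l a := fun l a => (hp l).1 a
  have hp1 : ∀ l, ∑ a, p l a = 1 := fun l => (hp l).2
  let r : Part → ℝ := partFamily (R₁ Part.p1) (min (R₁ Part.c1) (R₂ Part.c1))
    (min (R₁ Part.c2) (R₂ Part.c2)) (R₂ Part.p2)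
  have hr₁ : ∀ l ∈ decoded₁, r l ≤ R₁ l := fun l hl => by
    cases l
    · exact le_rfl
    · exact min_le_left _ _
    · exact min_le_left _ _
    · simp [decoded₁] at hl
  have hr₂ : ∀ l ∈ decoded₂, r l ≤ R₂ l := fun l hl => by
    cases l
    · simp [decoded₂] at hl
    · exact min_le_right _ _
    · exact min_le_right _ _
    · exact le_rfl
  obtain ⟨η₁, hη₁, hdec₁⟩ := exists_decoder (ρ := splitState₁ N f₁ f₂) hp
    (fun x => traceSecond_posSemidef (N.state_posSemidef _ _))
    (fun x => (trace_traceSecond _).trans (N.state_trace _ _)) π₁ (hR₁.mono hr₁) (half_pos hδ)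
  obtain ⟨η₂, hη₂, hdec₂⟩ := exists_decoder (ρ := splitState₂ N f₁ f₂) hp
    (fun x => traceFirst_posSemidef (N.state_posSemidef _ _))
    (fun x => (trace_traceFirst _).trans (N.state_trace _ _)) π₂ (hR₂.mono hr₂) (half_pos hδ)
  have hη := hη₁.add hη₂
  rw [add_zero] at hη
  obtain ⟨n₀, hn₀⟩ := Filter.eventually_atTop.1 (hη.eventually_le_const hε)
  refine ⟨n₀, fun n hn => ?_⟩
  set S₁ := R₁ Part.p1 + min (R₁ Part.c1) (R₂ Part.c1) - δ with hS₁
  set S₂ := min (R₁ Part.c2) (R₂ Part.c2) + R₂ Part.p2 - δ with hS₂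
  let L : Part → ℕ := fun l => numMessages n (r l - δ / 2)
  -- Each of the sender's two parts gives up `δ / 2`, which accounts for the loss `δ` in `S₁`.
  obtain ⟨s₁, hs₁⟩ := exists_injective_split n (a := r Part.p1 - δ / 2) (b := r Part.c1 - δ / 2)
    (c := S₁) (by simp only [hS₁, r, partFamily]; ring)
  obtain ⟨s₂, hs₂⟩ := exists_injective_split n (a := r Part.c2 - δ / 2) (b := r Part.p2 - δ / 2)
    (c := S₂) (by simp only [hS₂, r, partFamily]; ring)
  have : Nonempty (Fin (numMessages n S₁)) := ⟨⟨0, one_le_numMessages _ _⟩⟩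
  have : Nonempty (Fin (numMessages n S₂)) := ⟨⟨0, one_le_numMessages _ _⟩⟩
  -- Receiver 1 forgets its estimate of part `c2`; pairs outside the range of `s₁` are never sent,
  -- so the arbitrary value of `invFun` there is harmless.
  obtain ⟨Λ, hΛ⟩ := hdec₁ n (Fin (numMessages n S₁))
    (fun m => Function.invFun s₁ (m Part.p1, m Part.c1)) fun m m' h => by
      rw [h Part.p1 (by simp [decoded₁]), h Part.c1 (by simp [decoded₁])]
  obtain ⟨Γ, hΓ⟩ := hdec₂ n (Fin (numMessages n S₂))
    (fun m => Function.invFun s₂ (m Part.c2, m Part.p2)) fun m m' h => by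
      rw [h Part.c2 (by simp [decoded₂]), h Part.p2 (by simp [decoded₂])]
  let tup : Fin (numMessages n S₁) → Fin (numMessages n S₂) → ∀ l, Fin (L l) := fun m₁ m₂ =>
    partFamily (α := fun l => Fin (L l)) (s₁ m₁).1 (s₁ m₁).2 (s₂ m₂).1 (s₂ m₂).2
  let cw₁ : Codebook 𝒳 L n → Fin (numMessages n S₁) → Fin n → X₁ := fun c m₁ i =>
    f₁ (c i ⟨Part.p1, (s₁ m₁).1⟩) (c i ⟨Part.c1, (s₁ m₁).2⟩)
  let cw₂ : Codebook 𝒳 L n → Fin (numMessages n S₂) → Fin n → X₂ := fun c m₂ i =>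
    f₂ (c i ⟨Part.p2, (s₂ m₂).2⟩) (c i ⟨Part.c2, (s₂ m₂).1⟩)
  let err : Codebook 𝒳 L n → Fin (numMessages n S₁) → Fin (numMessages n S₂) → ℝ := fun c m₁ m₂ =>
    (((1 - Matrix.kroneckerMap (· * ·) ((Λ c).op m₁) ((Γ c).op m₂)) *
          N.blockState (cw₁ c m₁) (cw₂ c m₂)).trace).re
  have herr : ∀ m₁ m₂, ∑ c, codebookWeight p c * err c m₁ m₂ ≤ ε := fun m₁ m₂ => by
    have e₁ := hΛ (tup m₁ m₂)
    have e₂ := hΓ (tup m₁ m₂)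
    have i₁ : Function.invFun s₁ ((tup m₁ m₂) Part.p1, (tup m₁ m₂) Part.c1) = m₁ :=
      Function.leftInverse_invFun hs₁ m₁
    have i₂ : Function.invFun s₂ ((tup m₁ m₂) Part.c2, (tup m₁ m₂) Part.p2) = m₂ :=
      Function.leftInverse_invFun hs₂ m₂
    simp only [i₁] at e₁
    simp only [i₂] at e₂
    refine le_trans ?_ ((add_le_add e₁ e₂).trans (hn₀ n hn))
    rw [← Finset.sum_add_distrib]
    refine Finset.sum_le_sum fun c _ => ?_
    rw [← mul_add]
    refine mul_le_mul_of_nonneg_left ?_ (blockWeight_nonneg (fun q => hp0 q.1) c)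
    have h := expect_one_sub_kronecker_le (blockState_posSemidef N (cw₁ c m₁) (cw₂ c m₂))
      ((Λ c).op_le_one m₁) ((Γ c).op_le_one m₂)
    rw [traceSecond_blockState, traceFirst_blockState] at h
    exact h
  have hM₁ : (0 : ℝ) < numMessages n S₁ := by exact_mod_cast one_le_numMessages n S₁
  have hM₂ : (0 : ℝ) < numMessages n S₂ := by exact_mod_cast one_le_numMessages n S₂
  -- The message-averaged error has codebook average at most `ε`, so one codebook attains this at
  -- both receivers jointly.
  obtain ⟨c, hc⟩ := exists_le_of_sum_weight_mul_le
    (w := fun c : Codebook 𝒳 L n => codebookWeight p c)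
    (f := fun c => 1 / ((numMessages n S₁ : ℝ) * numMessages n S₂) * ∑ m₁, ∑ m₂, err c m₁ m₂)
    (ε := ε) (fun c => blockWeight_nonneg (fun q => hp0 q.1) c)
    (sum_blockWeight fun q : (Σ l, Fin (L l)) => hp1 q.1) (by
      have h1 : ∑ c : Codebook 𝒳 L n, codebookWeight p c *
          (1 / ((numMessages n S₁ : ℝ) * numMessages n S₂) * ∑ m₁, ∑ m₂, err c m₁ m₂) =
          1 / ((numMessages n S₁ : ℝ) * numMessages n S₂) *
            ∑ m₁, ∑ m₂, ∑ c, codebookWeight p c * err c m₁ m₂ := by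
        simp only [Finset.mul_sum]
        rw [Finset.sum_comm]
        refine Finset.sum_congr rfl fun m₁ _ => ?_
        rw [Finset.sum_comm]
        refine Finset.sum_congr rfl fun m₂ _ => Finset.sum_congr rfl fun c _ => ?_
        ring
      rw [h1, one_div_mul_eq_div, div_le_iff₀ (mul_pos hM₁ hM₂)]
      refine (Finset.sum_le_sum fun m₁ _ => Finset.sum_le_sum fun m₂ _ => herr m₁ m₂).trans
        (le_of_eq ?_)
      simp only [Finset.sum_const, Finset.card_univ, Fintype.card_fin, nsmul_eq_mul]
      ring)
  exact ⟨⟨cw₁ c, cw₂ c, Λ c, Γ c, hc⟩⟩
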